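/- **Setting.** Let $A_1,\dots,A_N\in GL_2(\mathbb R)$ satisfy $\|A_i\|<1$ (Euclidean operator norm), let $v_1,\dots,v_N\in\mathbb R^2$, $\varphi_i(x)=A_ix+v_i$, and let $X\subset\mathbb R^2$ be the self-affine set, i.e. the unique non-empty compact set with $X=\bigcup_i\varphi_i(X)$. Let $\Sigma=\{1,\dots,N\}^{\mathbb N}$, let $\Sigma_n$ be the set of words of length $n$, and for a finite word $w=w_1\cdots w_n$ put $A_w=A_{w_1}\cdots A_{w_n}$, $\alpha_1(w)=\|A_w\|$, $\alpha_2(w)=\|A_w^{-1}\|^{-1}$, $\overleftarrow{w}=w_n\cdots w_1$, and $[w]=\{\mathtt i\in\Sigma:\mathtt i|_n=w\}$, where $\mathtt i|_n=i_1\cdots i_n$. The canonical projection is $\pi(\mathtt i)=\sum_{n\ge1}A_{\mathtt i|_{n-1}}v_{i_n}$. Assume that $X$ is *dominated*: there are $C>0$ and $0<t<1$ such that $\alpha_2(w)\le Ct^{n}\alpha_1(w)$ for all $w\in\Sigma_n$ and all $n$; and that $X$ satisfies the *strong separation condition*: $\varphi_i(X)\cap\varphi_j(X)=\emptyset$ for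 $i\ne j$. Let $\mu$ be a Borel probability measure on $\Sigma$ which is fully supported ($\mu([w])>0$ for all $w$) and *quasi-Bernoulli*: there is $C\ge1$ with $C^{-1}\mu([u])\mu([w])\le\mu([uw])\le C\mu([u])\mu([w])$ for all finite words $u,w$. For $s\ge0$ let $\varphi^s(w)=\alpha_1(w)^s$ if $s<1$, $\varphi^s(w)=\alpha_1(w)\alpha_2(w)^{s-1}$ if $1\le s<2$, and $\varphi^s(w)=|\det A_w|^{s/2}$ if $s\ge2$. For $q\neq1$ let $s_q\ge0$ be the unique number with $$\lim_{n\to\infty}\frac1n\log\sum_{w\in\Sigma_n}\mu([w])^q\varphi^{s_q}(w)^{1-q}=0,$$ and put $\tau(q)=(q-1)s_q$. A *multicone* is a proper subset of $\mathbb{RP}^1$ which is a non-empty finite union of closed (non-degenerate) projective intervals; it is *strongly invariant* if $A_i\mathcal C\subset\mathcal C^o$ for all $i$. The set of *Furstenberg directions* is $$X_F=\bigcap_{n=1}^\infty\bigcup_{w\in\Sigma_n}A_{\overleftarrow{w}}^{-1}\,\overline{\mathbb{RP}^1\setminus\mathcal C},$$ where $\mathcal C$ is a strongly invariant multicone (one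 exists by domination, and $X_F$ does not depend on its choice). For a line $V$ let $\mathrm{proj}_{V^\perp}$ be the orthogonal projection onto $V^\perp$. Balls $B(x,r)$ are closed. For $s\ge 0$ let $X_s$ be the set of those $x\in X$ for which $\lim_{r\downarrow0}\log\pi_*\mu(B(x,r))/\log r$ exists and equals $s$. **Proposition.** Let $q>1$ and suppose that one of the following holds: 1. $0\le\tau(q)/(q-1)\le1$ and there are $\varrho_3>0$ and $C\ge1$ such that $\pi_*\mu\big(B(\pi(\mathtt i),\varrho_3\alpha_1(\mathtt i|_n))\big)\le C\mu([\mathtt i|_n])$ for all $\mathtt i\in\Sigma$ and $n\in\mathbb N$; 2. $1\le\tau(q)/(q-1)\le2$ and there is $C\ge1$ such that $(\mathrm{proj}_{V^\perp})_*(\pi_*\mu)\big(\mathrm{proj}_{V^\perp}(B(x,r))\big)\le Cr$ for all $x\in\mathbb R^2$, $V\in X_F$ and $r>0$. Then $\dim_H X_s\le qs-\tau(q)$ for every $s\ge0$, with the convention $\dim_H\emptyset=-\infty$ (so that, in particular, $X_s=\emptyset$ whenever $qs<\tau(q)$). -/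

import Mathlib

open Filter Topology MeasureTheory
open scoped LinearAlgebra.Projectivization ENNReal

noncomputable section

namespace SelfAffine

/-- The Euclidean plane. -/
abbrev Plane : Type := EuclideanSpace ℝ (Fin 2)

/-! ### Words, cylinders and potentials

The alphabet is `Fin N`, the shift space `Σ` is `ℕ → Fin N` (letters indexed from `0`), and the
finite words are the lists over `Fin N`. -/

/-- The prefix `i|ₙ`, consisting of the first `n` letters of the infinite word `i`. -/
def pre {N : ℕ} (i : ℕ → Fin N) (n : ℕ) : List (Fin N) :=
  List.ofFn fun k : Fin n => i k

/-- The cylinder set `[w]` of infinite words with prefix `w`. -/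
def wordCylinder {N : ℕ} (w : List (Fin N)) : Set (ℕ → Fin N) :=
  {i | pre i w.length = w}

/-- Almost-multiplicativity of a potential `θ` on finite words. -/
def IsAlmostMultiplicative {N : ℕ} (θ : List (Fin N) → ℝ) : Prop :=
  ∃ C : ℝ, 1 ≤ C ∧ ∀ u w : List (Fin N),
    C⁻¹ * (θ u * θ w) ≤ θ (u ++ w) ∧ θ (u ++ w) ≤ C * (θ u * θ w)

/-- Every cylinder set has positive measure. -/
def IsFullySupported {N : ℕ} (μ : Measure (ℕ → Fin N)) : Prop :=
  ∀ w : List (Fin N), 0 < μ (wordCylinder w)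

/-- Quasi-Bernoulli measures: `w ↦ μ([w])` is almost-multiplicative. Shift invariance is not
required. -/
def IsQuasiBernoulli {N : ℕ} (μ : Measure (ℕ → Fin N)) : Prop :=
  IsAlmostMultiplicative fun w => μ.real (wordCylinder w)

/-- The pressure of the potential `θ` exists and equals `p`:
`p = lim (1/n) log ∑_{w ∈ Σₙ} θ(w)`. -/
def HasPressure {N : ℕ} (θ : List (Fin N) → ℝ) (p : ℝ) : Prop :=
  Tendsto (fun n : ℕ => (1 / (n : ℝ)) * Real.log (∑ w : Fin n → Fin N, θ (List.ofFn w)))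
    atTop (𝓝 p)

/-! ### Matrix products and singular values -/

/-- The linear map of the Euclidean plane given by a matrix. -/
def linMap (B : GL (Fin 2) ℝ) : Plane →L[ℝ] Plane :=
  Matrix.toEuclideanCLM (n := Fin 2) (𝕜 := ℝ) (B : Matrix (Fin 2) (Fin 2) ℝ)

/-- `A_w = A_{w₁} ⋯ A_{wₙ}`. -/
def wordProd {N : ℕ} (A : Fin N → GL (Fin 2) ℝ) (w : List (Fin N)) : GL (Fin 2) ℝ :=
  (w.map A).prod

/-- The larger singular value `α₁(w) = ‖A_w‖` (Euclidean operator norm). -/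
def alpha1 {N : ℕ} (A : Fin N → GL (Fin 2) ℝ) (w : List (Fin N)) : ℝ :=
  ‖linMap (wordProd A w)‖

/-- The smaller singular value `α₂(w) = ‖A_w⁻¹‖⁻¹`. -/
def alpha2 {N : ℕ} (A : Fin N → GL (Fin 2) ℝ) (w : List (Fin N)) : ℝ :=
  ‖linMap (wordProd A w)⁻¹‖⁻¹

/-- Domination: `α₂(w) ≤ C t^{|w|} α₁(w)` for all words `w`, for some `C > 0` and `0 < t < 1`. -/
def IsDominated {N : ℕ} (A : Fin N → GL (Fin 2) ℝ) : Prop :=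
  ∃ C t : ℝ, 0 < C ∧ 0 < t ∧ t < 1 ∧
    ∀ w : List (Fin N), alpha2 A w ≤ C * t ^ w.length * alpha1 A w

/-- The singular value function `φˢ`, for `s ≥ 0`. -/
def svf {N : ℕ} (A : Fin N → GL (Fin 2) ℝ) (s : ℝ) (w : List (Fin N)) : ℝ :=
  if s < 1 then alpha1 A w ^ s
  else if s < 2 then alpha1 A w * alpha2 A w ^ (s - 1)
  else |(wordProd A w : Matrix (Fin 2) (Fin 2) ℝ).det| ^ (s / 2)

/-- The potential `ψ^{q,s}(w) = μ([w])^q φˢ(w)^{1-q}`. -/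
def psi {N : ℕ} (A : Fin N → GL (Fin 2) ℝ) (μ : Measure (ℕ → Fin N)) (q s : ℝ)
    (w : List (Fin N)) : ℝ :=
  μ.real (wordCylinder w) ^ q * svf A s w ^ (1 - q)

/-- The zero `s_q ≥ 0` of the pressure `s ↦ P(ψ^{q,s})`, which exists and is unique for `q ≠ 1`
when the matrices are contractive and dominated and `μ` is fully supported quasi-Bernoulli, so
that the infimum below is over a one-point set. -/
def pressureZero {N : ℕ} (A : Fin N → GL (Fin 2) ℝ) (μ : Measure (ℕ → Fin N)) (q : ℝ) : ℝ :=
  sInf {s : ℝ | 0 ≤ s ∧ HasPressure (psi A μ q s) 0}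

/-- The (symbolic) `L^q`-spectrum: `τ(q) = (q - 1) s_q` for `q ≠ 1`, and `τ(1) = 0`. -/
def lqSpectrum {N : ℕ} (A : Fin N → GL (Fin 2) ℝ) (μ : Measure (ℕ → Fin N)) (q : ℝ) : ℝ :=
  if q = 1 then 0 else (q - 1) * pressureZero A μ q

/-! ### The projective line and Furstenberg directions -/

/-- The quotient topology on the real projective line. -/
instance projectiveLineTopology : TopologicalSpace (ℙ ℝ Plane) :=
  TopologicalSpace.coinduced (Projectivization.mk' ℝ) inferInstance

theorem linMap_injective (B : GL (Fin 2) ℝ) :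
    Function.Injective (linMap B : Plane →ₗ[ℝ] Plane) := by
  have h : linMap B⁻¹ * linMap B = 1 := by
    simp only [linMap]
    rw [← map_mul, ← Units.val_mul, inv_mul_cancel, Units.val_one, map_one]
  intro x y hxy
  have hx := congrArg (fun T : Plane →L[ℝ] Plane => T x) h
  have hy := congrArg (fun T : Plane →L[ℝ] Plane => T y) h
  simp only [mul_apply_eq_comp, one_apply_eq_self] at hx hy
  rw [← hx, ← hy]
  exact congrArg (linMap B⁻¹) hxy

/-- The action of an invertible matrix on lines through the origin. -/
def lineMap (B : GL (Fin 2) ℝ) : ℙ ℝ Plane → ℙ ℝ Plane :=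
  Projectivization.map (linMap B : Plane →ₗ[ℝ] Plane) (linMap_injective B)

/-- The closed projective interval of lines with angle in `[a, b]` (modulo `π`). -/
def projInterval (a b : ℝ) : Set (ℙ ℝ Plane) :=
  {V | ∃ θ ∈ Set.Icc a b, !₂[Real.cos θ, Real.sin θ] ∈ V.submodule}

/-- A multicone: a proper subset of the projective line which is a (non-empty) finite union of
closed projective intervals. -/
def IsMulticone (S : Set (ℙ ℝ Plane)) : Prop :=
  S ≠ Set.univ ∧ ∃ (k : ℕ) (a b : Fin k → ℝ), 0 < k ∧ (∀ j, a j < b j) ∧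
    S = ⋃ j, projInterval (a j) (b j)

/-- A multicone `S` is strongly invariant for `A` if `A_i S ⊆ int S` for all `i`. -/
def IsStronglyInvariantMulticone {N : ℕ} (A : Fin N → GL (Fin 2) ℝ)
    (S : Set (ℙ ℝ Plane)) : Prop :=
  IsMulticone S ∧ ∀ i, lineMap (A i) '' S ⊆ interior S

/-- The set `⋂_{n ≥ 1} ⋃_{w ∈ Σₙ} A_{w reversed}⁻¹ (closure of the complement of S)`. -/
def furstenbergSet {N : ℕ} (A : Fin N → GL (Fin 2) ℝ) (S : Set (ℙ ℝ Plane)) :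
    Set (ℙ ℝ Plane) :=
  ⋂ (n : ℕ) (_ : 1 ≤ n), ⋃ w : Fin n → Fin N,
    lineMap (wordProd A (List.ofFn w).reverse)⁻¹ '' closure Sᶜ

/-- The set `X_F` of Furstenberg directions of a dominated tuple `A`. A dominated tuple has a
strongly invariant multicone `S`, and `furstenbergSet A S` is the same set for every such `S`;
the intersection over all of them is this common value. -/
def furstenbergDirections {N : ℕ} (A : Fin N → GL (Fin 2) ℝ) : Set (ℙ ℝ Plane) :=
  ⋂ (S : Set (ℙ ℝ Plane)) (_ : IsStronglyInvariantMulticone A S), furstenbergSet A S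

/-- The orthogonal projection of the plane onto `V^⊥`. -/
def projPerp (V : ℙ ℝ Plane) : Plane →L[ℝ] Plane :=
  (V.submoduleᗮ).starProjection

/-! ### Self-affine sets -/

/-- The affine map `φ_i(x) = A_i x + v_i`. -/
def affMap {N : ℕ} (A : Fin N → GL (Fin 2) ℝ) (v : Fin N → Plane) (i : Fin N) (x : Plane) :
    Plane :=
  linMap (A i) x + v i

/-- `X` is the self-affine set of the maps `φ_i`: the non-empty compact set with
`X = ⋃_i φ_i(X)`, unique when the maps are contractive. -/
def IsSelfAffineSet {N : ℕ} (A : Fin N → GL (Fin 2) ℝ) (v : Fin N → Plane)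
    (X : Set Plane) : Prop :=
  X.Nonempty ∧ IsCompact X ∧ X = ⋃ i, affMap A v i '' X

/-- The strong separation condition. -/
def StrongSeparation {N : ℕ} (A : Fin N → GL (Fin 2) ℝ) (v : Fin N → Plane)
    (X : Set Plane) : Prop :=
  ∀ i j, i ≠ j → Disjoint (affMap A v i '' X) (affMap A v j '' X)

/-- The canonical projection `π(i) = ∑_{n ≥ 1} A_{i|_{n-1}} v_{i_n}`. -/
def canonicalProj {N : ℕ} (A : Fin N → GL (Fin 2) ℝ) (v : Fin N → Plane) (i : ℕ → Fin N) :
    Plane :=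
  ∑' n : ℕ, linMap (wordProd A (pre i n)) (v (i n))

/-! ### Local dimension -/

/-- The local dimension of `m` at `x` exists and equals `s`. -/
def HasLocalDim (m : Measure Plane) (x : Plane) (s : ℝ) : Prop :=
  Tendsto (fun r : ℝ => Real.log (m.real (Metric.closedBall x r)) / Real.log r) (𝓝[>] 0) (𝓝 s)

/-- The level set of points of `X` at which the local dimension of `m` is `s`. -/
def levelSet (X : Set Plane) (m : Measure Plane) (s : ℝ) : Set Plane :=
  {x ∈ X | HasLocalDim m x s}

/-- Hausdorff dimension with the convention that the empty set has dimension `-∞`. -/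
def hausdorffDim (E : Set Plane) : EReal :=
  open Classical in if E = ∅ then ⊥ else ((dimH E : ℝ≥0∞) : EReal)

end SelfAffine

end

/-! Write m for the projected measure, take T < τ(q) and put t = T/(q-1), so that t < s_q.
Everything rests on one counting estimate at each small scale r (`HasLqBound`): X is cut into cells
of diameter O(r), grouped by finite words w with M(w) cells in class w, such that M(w) m(B(x,r))^q ≤
C r^T ψ(w) for x in class w, with ψ summable. On the set where m(B(x,r)) ≥ r^p for all r < δ this
gives M(w) r^(pq-T) ≤ C ψ(w) for every class met. Summing over w bounds the (pq-T)-dimensional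
Hausdorff measure if pq > T, and r → 0 excludes every point if pq < T. For each p > s the level set
is covered by countably many such sets; p → s and T → τ(q) finish the argument
(`hausdorffDim_levelSet_le`).

The weight ψ(w) is μ([w])^q times the power 1-q of the singular value expression with exponent t.
Since 1-q < 0, for t ≥ 0 the potential is super-multiplicative up to a constant, so its pressure
exists by Fekete's lemma. The pressure is continuous in the exponent and nonpositive at 0, hence
negative below its first zero (`exists_hasPressure_neg`). Then ψ is summable over all finite words,
and the words selected at scale r need no finer control.

Under the first condition the cells are cylinders with α₁(w) ≈ r (`hasLqBound_of_ball_le_cylinder`).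
Under the second they are cylinders with α₂(w) ≈ r, cut into about α₁/α₂ pieces
(`hasLqBound_of_projections`). By strong separation a small ball sees a single cylinder, and its
pullback under A_w lies in a strip of width about α₂/α₁; quasi-Bernoulli and the projection bound
give it measure at most about μ([w]) α₂/α₁. For this the strip must be parallel to a Furstenberg
direction, which is the geometric core: every word contracts some direction of X_F at rate α₂(w), up
to a uniform constant (`exists_furstenbergDirection_contracted`). -/

namespace SelfAffine

/-! ### Planar linear algebra -/

/-- The standard area form of the plane. -/
def wedge (x y : Plane) : ℝ := x 0 * y 1 - x 1 * y 0

/-- Rotation of the plane by a right angle. -/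
def rot (x : Plane) : Plane := !₂[-x 1, x 0]

theorem norm_sq_plane (x : Plane) : ‖x‖ ^ 2 = x 0 ^ 2 + x 1 ^ 2 := by
  rw [EuclideanSpace.norm_sq_eq, Fin.sum_univ_two]
  simp

theorem wedge_rot (x : Plane) : wedge x (rot x) = ‖x‖ ^ 2 := by
  rw [norm_sq_plane]; simp [wedge, rot]; ring

theorem norm_rot (x : Plane) : ‖rot x‖ = ‖x‖ := by
  rw [← sq_eq_sq₀ (norm_nonneg _) (norm_nonneg _), norm_sq_plane, norm_sq_plane]
  simp [rot]; ring

theorem abs_wedge_le (x y : Plane) : |wedge x y| ≤ ‖x‖ * ‖y‖ := by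
  apply abs_le_of_sq_le_sq _ (by positivity)
  rw [mul_pow, norm_sq_plane, norm_sq_plane, wedge]
  nlinarith [sq_nonneg (x 0 * y 0 + x 1 * y 1)]

theorem continuous_wedge : Continuous fun p : Plane × Plane => wedge p.1 p.2 := by
  unfold wedge; fun_prop

theorem wedge_smul_left (c : ℝ) (x y : Plane) : wedge (c • x) y = c * wedge x y := by
  simp [wedge]; ring

theorem wedge_smul_right (c : ℝ) (x y : Plane) : wedge x (c • y) = c * wedge x y := by
  simp [wedge]; ring

theorem wedge_self (x : Plane) : wedge x x = 0 := by simp [wedge]; ring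

/-- Cramer's rule in the plane. With z = `rot y` it yields orthogonal coordinates, and with y, z
independent it bounds operator norms from two test vectors. -/
theorem wedge_smul_eq (x y z : Plane) :
    wedge y z • x = wedge x z • y + wedge y x • z := by
  ext i; fin_cases i <;> simp [wedge] <;> ring

theorem mem_span_singleton_iff_wedge {x y : Plane} (hx : x ≠ 0) :
    y ∈ Submodule.span ℝ {x} ↔ wedge x y = 0 := by
  rw [Submodule.mem_span_singleton]
  constructor
  · rintro ⟨c, rfl⟩
    rw [wedge_smul_right, wedge_self, mul_zero]
  · intro h
    have hn : ‖x‖ ^ 2 ≠ 0 := by simpa using hx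
    have key := wedge_smul_eq y x (rot x)
    rw [wedge_rot, h, zero_smul, add_zero] at key
    refine ⟨(‖x‖ ^ 2)⁻¹ * wedge y (rot x), ?_⟩
    rw [mul_smul, ← key, smul_smul, inv_mul_cancel₀ hn, one_smul]

/-! ### Singular values of matrices -/

theorem linMap_mul (B C : GL (Fin 2) ℝ) (x : Plane) : linMap (B * C) x = linMap B (linMap C x) := by
  simp [linMap]

theorem linMap_one (x : Plane) : linMap 1 x = x := by simp [linMap]

theorem linMap_inv_apply (B : GL (Fin 2) ℝ) (x : Plane) : linMap B⁻¹ (linMap B x) = x := by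
  rw [← linMap_mul, inv_mul_cancel, linMap_one]

theorem linMap_apply_inv (B : GL (Fin 2) ℝ) (x : Plane) : linMap B (linMap B⁻¹ x) = x := by
  rw [← linMap_mul, mul_inv_cancel, linMap_one]

theorem linMap_ne_zero (B : GL (Fin 2) ℝ) {x : Plane} (hx : x ≠ 0) : linMap B x ≠ 0 := by
  intro h
  apply hx
  rw [← linMap_inv_apply B x, h, map_zero]

theorem wedge_linMap (B : GL (Fin 2) ℝ) (x y : Plane) :
    wedge (linMap B x) (linMap B y) = (B : Matrix (Fin 2) (Fin 2) ℝ).det * wedge x y := by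
  have h (z : Plane) (i : Fin 2) : linMap B z i = B i 0 * z 0 + B i 1 * z 1 := by
    simp [linMap, Matrix.ofLp_toEuclideanCLM, Matrix.mulVec, dotProduct, Fin.sum_univ_two]
  simp only [wedge, h, Matrix.det_fin_two]
  ring

/-- The absolute value of the determinant. -/
def absDet (B : GL (Fin 2) ℝ) : ℝ := |(B : Matrix (Fin 2) (Fin 2) ℝ).det|

theorem absDet_pos (B : GL (Fin 2) ℝ) : 0 < absDet B :=
  abs_pos.2 ((Matrix.isUnit_iff_isUnit_det _).1 B.isUnit).ne_zero

theorem absDet_mul (B C : GL (Fin 2) ℝ) : absDet (B * C) = absDet B * absDet C := by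
  simp [absDet, abs_mul]

theorem absDet_inv (B : GL (Fin 2) ℝ) : absDet B⁻¹ = (absDet B)⁻¹ := by
  apply eq_inv_of_mul_eq_one_left
  rw [← absDet_mul, inv_mul_cancel]; simp [absDet]

/-- For x = B⁻¹z, the area spanned by Bx and B(`rot x`) is |det B| ‖x‖², and it is at most ‖z‖ ‖B‖
‖x‖. Applied to B⁻¹ as well, this makes the two singular values multiply to |det B|. -/
theorem norm_linMap_inv_le (B : GL (Fin 2) ℝ) :
    ‖linMap B⁻¹‖ ≤ ‖linMap B‖ / absDet B := by
  refine ContinuousLinearMap.opNorm_le_bound _ (div_nonneg (norm_nonneg _) (abs_nonneg _)) fun z => ?_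
  set x := linMap B⁻¹ z with hx
  rcases eq_or_ne x 0 with h0 | h0
  · rw [h0, norm_zero]
    exact mul_nonneg (div_nonneg (norm_nonneg _) (abs_nonneg _)) (norm_nonneg _)
  have hxp : 0 < ‖x‖ := norm_pos_iff.2 h0
  have hz : linMap B x = z := linMap_apply_inv B z
  have h1 := abs_wedge_le (linMap B x) (linMap B (rot x))
  rw [wedge_linMap, wedge_rot, abs_mul, abs_of_nonneg (sq_nonneg ‖x‖), hz] at h1
  have h2 : ‖linMap B (rot x)‖ ≤ ‖linMap B‖ * ‖x‖ := by
    simpa [norm_rot] using (linMap B).le_opNorm (rot x)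
  have h3 : absDet B * ‖x‖ ^ 2 ≤ ‖z‖ * (‖linMap B‖ * ‖x‖) :=
    h1.trans (mul_le_mul_of_nonneg_left h2 (norm_nonneg _))
  rw [div_mul_eq_mul_div, le_div_iff₀ (absDet_pos B)]
  refine le_of_mul_le_mul_right ?_ hxp
  nlinarith

theorem norm_linMap_inv (B : GL (Fin 2) ℝ) : ‖linMap B⁻¹‖ = ‖linMap B‖ / absDet B := by
  refine le_antisymm (norm_linMap_inv_le B) ?_
  have h := norm_linMap_inv_le B⁻¹
  rw [inv_inv, absDet_inv, div_inv_eq_mul] at h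
  rwa [div_le_iff₀ (absDet_pos B)]

theorem norm_linMap_pos (B : GL (Fin 2) ℝ) : 0 < ‖linMap B‖ := by
  refine norm_pos_iff.2 fun h => ?_
  have : (!₂[1, 0] : Plane) ≠ 0 := fun h => by simpa using congrArg (fun x : Plane => x 0) h
  exact linMap_ne_zero B this (by rw [h]; rfl)

theorem le_norm_linMap (B : GL (Fin 2) ℝ) (x : Plane) :
    ‖linMap B⁻¹‖⁻¹ * ‖x‖ ≤ ‖linMap B x‖ := by
  rw [inv_mul_le_iff₀ (norm_linMap_pos _)]
  simpa [linMap_inv_apply] using (linMap B⁻¹).le_opNorm (linMap B x)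

/-! ### Singular values of word products -/

section Words

variable {N : ℕ} (A : Fin N → GL (Fin 2) ℝ)

theorem wordProd_append (u w : List (Fin N)) :
    wordProd A (u ++ w) = wordProd A u * wordProd A w := by simp [wordProd]

theorem wordProd_nil : wordProd A [] = 1 := by simp [wordProd]

theorem wordProd_singleton (i : Fin N) : wordProd A [i] = A i := by simp [wordProd]

theorem alpha1_pos (w : List (Fin N)) : 0 < alpha1 A w := norm_linMap_pos _

theorem alpha2_pos (w : List (Fin N)) : 0 < alpha2 A w := inv_pos.2 (norm_linMap_pos _)

theorem alpha1_mul_alpha2 (w : List (Fin N)) :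
    alpha1 A w * alpha2 A w = absDet (wordProd A w) := by
  have h1 := alpha1_pos A w
  rw [alpha2, norm_linMap_inv, inv_div]
  exact mul_div_cancel₀ _ h1.ne'

theorem norm_linMap_le (w : List (Fin N)) (x : Plane) :
    ‖linMap (wordProd A w) x‖ ≤ alpha1 A w * ‖x‖ := (linMap _).le_opNorm x

theorem alpha2_mul_norm_le (w : List (Fin N)) (x : Plane) :
    alpha2 A w * ‖x‖ ≤ ‖linMap (wordProd A w) x‖ := le_norm_linMap _ x

theorem exists_unit_vector : ∃ x : Plane, ‖x‖ = 1 :=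
  ⟨!₂[1, 0], by rw [← sq_eq_sq₀ (norm_nonneg _) zero_le_one, norm_sq_plane]; simp⟩

theorem alpha2_le_alpha1 (w : List (Fin N)) : alpha2 A w ≤ alpha1 A w := by
  obtain ⟨x, hx⟩ := exists_unit_vector
  simpa [hx] using (alpha2_mul_norm_le A w x).trans (norm_linMap_le A w x)

theorem alpha1_append_le (u w : List (Fin N)) :
    alpha1 A (u ++ w) ≤ alpha1 A u * alpha1 A w := by
  refine ContinuousLinearMap.opNorm_le_bound _
    (mul_pos (alpha1_pos A u) (alpha1_pos A w)).le fun x => ?_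
  rw [wordProd_append, linMap_mul, mul_assoc]
  exact (norm_linMap_le A u _).trans
    (mul_le_mul_of_nonneg_left (norm_linMap_le A w x) (alpha1_pos A u).le)

theorem absDet_append (u w : List (Fin N)) :
    absDet (wordProd A (u ++ w)) = absDet (wordProd A u) * absDet (wordProd A w) := by
  rw [wordProd_append, absDet_mul]

theorem le_alpha2_append (u w : List (Fin N)) :
    alpha2 A u * alpha2 A w ≤ alpha2 A (u ++ w) := by
  have h := absDet_append A u w
  rw [← alpha1_mul_alpha2, ← alpha1_mul_alpha2, ← alpha1_mul_alpha2] at h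
  have h1 := alpha1_append_le A u w
  refine le_of_mul_le_mul_left ?_ (mul_pos (alpha1_pos A u) (alpha1_pos A w))
  calc _ = alpha1 A (u ++ w) * alpha2 A (u ++ w) := by rw [h]; ring
    _ ≤ _ := mul_le_mul_of_nonneg_right h1 (alpha2_pos A _).le

/-- Factor A_u = A_{uw} A_w⁻¹ and take norms. -/
theorem alpha1_mul_alpha2_le_append (u w : List (Fin N)) :
    alpha1 A u * alpha2 A w ≤ alpha1 A (u ++ w) := by
  have h2 : alpha1 A u ≤ alpha1 A (u ++ w) / alpha2 A w := by
    refine ContinuousLinearMap.opNorm_le_bound _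
      (div_pos (alpha1_pos A _) (alpha2_pos A _)).le fun x => ?_
    rw [div_mul_eq_mul_div, le_div_iff₀ (alpha2_pos A w)]
    have e1 := norm_linMap_le A (u ++ w) (linMap (wordProd A w)⁻¹ x)
    rw [wordProd_append, linMap_mul, linMap_apply_inv] at e1
    have e2 := alpha2_mul_norm_le A w (linMap (wordProd A w)⁻¹ x)
    rw [linMap_apply_inv] at e2
    have h1 := alpha1_pos A (u ++ w)
    have h2 := alpha2_pos A w
    nlinarith [mul_le_mul_of_nonneg_left e2 h1.le, mul_le_mul_of_nonneg_right e1 h2.le]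
  rwa [le_div_iff₀ (alpha2_pos A w)] at h2

theorem alpha2_append_le (u w : List (Fin N)) :
    alpha2 A (u ++ w) ≤ alpha2 A u * alpha1 A w := by
  have h := absDet_append A u w
  rw [← alpha1_mul_alpha2, ← alpha1_mul_alpha2, ← alpha1_mul_alpha2] at h
  have h1 := alpha1_mul_alpha2_le_append A u w
  have h3 := mul_le_mul_of_nonneg_right h1 (alpha2_pos A (u ++ w)).le
  rw [h] at h3
  refine le_of_mul_le_mul_left ?_ (mul_pos (alpha1_pos A u) (alpha2_pos A w))
  linarith

theorem alpha1_nil : alpha1 A [] = 1 := by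
  obtain ⟨x, hx⟩ := exists_unit_vector
  apply le_antisymm
  · exact ContinuousLinearMap.opNorm_le_bound _ zero_le_one fun x => by
      rw [wordProd_nil, linMap_one, one_mul]
  · simpa [wordProd_nil, linMap_one, hx] using norm_linMap_le A [] x

theorem alpha2_nil : alpha2 A [] = 1 := by
  have h := alpha1_mul_alpha2 A []
  rw [alpha1_nil, one_mul] at h
  rw [h]; simp [wordProd_nil, absDet]

theorem exists_alpha1_le_pow (hcontr : ∀ i, ‖linMap (A i)‖ < 1) :
    ∃ l : ℝ, 0 < l ∧ l < 1 ∧ ∀ w : List (Fin N), alpha1 A w ≤ l ^ w.length := by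
  obtain ⟨l, hl, h⟩ : ∃ l : ℝ, (0 < l ∧ l < 1) ∧ ∀ i, ‖linMap (A i)‖ ≤ l := by
    rcases isEmpty_or_nonempty (Fin N) with h | h
    · exact ⟨1 / 2, by norm_num, fun i => (h.false i).elim⟩
    · obtain ⟨i, hi⟩ := Finite.exists_max fun i => ‖linMap (A i)‖
      exact ⟨_, ⟨norm_linMap_pos _, hcontr i⟩, hi⟩
  refine ⟨l, hl.1, hl.2, fun w => ?_⟩
  induction w with
  | nil => simp [alpha1_nil]
  | cons a w ih =>
    have h1 := alpha1_append_le A [a] w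
    have h2 : alpha1 A [a] ≤ l := by rw [alpha1, wordProd_singleton]; exact h a
    rw [List.singleton_append] at h1
    rw [List.length_cons, pow_succ']
    exact h1.trans (mul_le_mul h2 ih (alpha1_pos A _).le hl.1.le)

theorem exists_pow_le_alpha2 :
    ∃ k : ℝ, 0 < k ∧ k ≤ 1 ∧ ∀ w : List (Fin N), k ^ w.length ≤ alpha2 A w := by
  obtain ⟨k, hk, h⟩ : ∃ k : ℝ, (0 < k ∧ k ≤ 1) ∧ ∀ i, k ≤ alpha2 A [i] := by
    rcases isEmpty_or_nonempty (Fin N) with h | h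
    · exact ⟨1 / 2, by norm_num, fun i => (h.false i).elim⟩
    · obtain ⟨i, hi⟩ := Finite.exists_min fun i => alpha2 A [i]
      exact ⟨min (alpha2 A [i]) 1, ⟨lt_min (alpha2_pos A _) one_pos, min_le_right _ _⟩,
        fun j => (min_le_left _ _).trans (hi j)⟩
  refine ⟨k, hk.1, hk.2, fun w => ?_⟩
  induction w with
  | nil => simp [alpha2_nil]
  | cons a w ih =>
    have h1 := le_alpha2_append A [a] w
    rw [List.singleton_append] at h1
    rw [List.length_cons, pow_succ']
    exact (mul_le_mul (h a) ih (pow_pos hk.1 _).le (alpha2_pos A _).le).trans h1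

end Words

/-! ### Cones and multicones -/

/-- The non-zero vectors spanning a line in `S`. -/
def cone (S : Set (ℙ ℝ Plane)) : Set Plane := {x | ∃ h : x ≠ 0, Projectivization.mk ℝ x h ∈ S}

theorem mk_mem_iff_mem_cone {S : Set (ℙ ℝ Plane)} {x : Plane} (hx : x ≠ 0) :
    Projectivization.mk ℝ x hx ∈ S ↔ x ∈ cone S := ⟨fun h => ⟨hx, h⟩, fun ⟨_, h⟩ => h⟩

theorem mem_cone_compl {S : Set (ℙ ℝ Plane)} {x : Plane} (hx : x ≠ 0) :
    x ∈ cone Sᶜ ↔ x ∉ cone S := by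
  rw [← mk_mem_iff_mem_cone hx, ← mk_mem_iff_mem_cone hx, Set.mem_compl_iff]

theorem cone_mono {S T : Set (ℙ ℝ Plane)} (h : S ⊆ T) : cone S ⊆ cone T :=
  fun _ ⟨hx, hS⟩ => ⟨hx, h hS⟩

theorem mem_cone_of_wedge_eq_zero {S : Set (ℙ ℝ Plane)} {x y : Plane} (hx : x ∈ cone S)
    (hy : y ≠ 0) (h : wedge x y = 0) : y ∈ cone S := by
  obtain ⟨hx0, hxS⟩ := hx
  refine ⟨hy, ?_⟩
  convert hxS using 1
  rw [Projectivization.mk_eq_mk_iff']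
  exact Submodule.mem_span_singleton.1 ((mem_span_singleton_iff_wedge hx0).2 h)

theorem smul_mem_cone {S : Set (ℙ ℝ Plane)} {x : Plane} (hx : x ∈ cone S) {c : ℝ} (hc : c ≠ 0) :
    c • x ∈ cone S :=
  mem_cone_of_wedge_eq_zero hx (smul_ne_zero hc hx.1) (by rw [wedge_smul_right, wedge_self, mul_zero])

theorem linMap_mem_cone_image (B : GL (Fin 2) ℝ) {S : Set (ℙ ℝ Plane)} {x : Plane}
    (hx : x ∈ cone S) : linMap B x ∈ cone (lineMap B '' S) :=
  ⟨linMap_ne_zero B hx.1, _, hx.2, Projectivization.map_mk _ _ _ _⟩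

theorem cone_eq_image (S : Set (ℙ ℝ Plane)) :
    cone S = Subtype.val '' (Projectivization.mk' ℝ ⁻¹' S : Set {x : Plane // x ≠ 0}) := by
  ext x
  constructor
  · rintro ⟨h, hS⟩
    exact ⟨⟨x, h⟩, hS, rfl⟩
  · rintro ⟨y, hy, rfl⟩
    exact ⟨y.2, hy⟩

theorem isOpen_cone {S : Set (ℙ ℝ Plane)} (hS : IsOpen S) : IsOpen (cone S) := by
  rw [cone_eq_image]
  exact isOpen_ne.isOpenMap_subtype_val _ (isOpen_coinduced.1 hS)

theorem isCompact_sphere_diff_cone {S : Set (ℙ ℝ Plane)} (hS : IsOpen S) :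
    IsCompact (Metric.sphere (0 : Plane) 1 \ cone S) :=
  (isCompact_sphere _ _).diff (isOpen_cone hS)

theorem isCompact_sphere_inter_cone {S : Set (ℙ ℝ Plane)} (hS : IsClosed S) :
    IsCompact (Metric.sphere (0 : Plane) 1 ∩ cone S) := by
  have : Metric.sphere (0 : Plane) 1 ∩ cone S = Metric.sphere (0 : Plane) 1 \ cone Sᶜ := by
    ext x
    simp only [Set.mem_inter_iff, Set.mem_sdiff, and_congr_right_iff]
    intro hx
    have hx0 : x ≠ 0 := by rintro rfl; simp at hx
    rw [mem_cone_compl hx0, not_not]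
  rw [this]
  exact isCompact_sphere_diff_cone hS.isOpen_compl

/-- The preimage in the punctured plane is the projection of a closed incidence relation along the
compact interval of angles. -/
theorem isClosed_projInterval (a b : ℝ) : IsClosed (projInterval a b) := by
  have key : IsClosed (Projectivization.mk' ℝ ⁻¹' projInterval a b : Set {x : Plane // x ≠ 0}) := by
    have h1 : (Projectivization.mk' ℝ ⁻¹' projInterval a b : Set {x : Plane // x ≠ 0}) =
        Prod.snd '' {p : Set.Icc a b × {x : Plane // x ≠ 0} |
          wedge p.2.1 !₂[Real.cos p.1, Real.sin p.1] = 0} := by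
      ext ⟨x, hx⟩
      simp only [Set.mem_preimage, Projectivization.mk'_eq_mk, projInterval, Set.mem_ofPred_eq,
        Projectivization.submodule_mk, mem_span_singleton_iff_wedge hx, Set.mem_image]
      constructor
      · rintro ⟨θ, hθ, h⟩
        exact ⟨(⟨θ, hθ⟩, ⟨x, hx⟩), h, rfl⟩
      · rintro ⟨⟨θ, y⟩, h, rfl⟩
        exact ⟨θ, θ.2, h⟩
    rw [h1]
    refine isClosedMap_snd_of_compactSpace _ (isClosed_eq ?_ continuous_const)
    simp only [wedge]
    simp
    fun_prop
  exact ⟨isOpen_coinduced.2 key.isOpen_compl⟩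

theorem IsMulticone.isClosed {S : Set (ℙ ℝ Plane)} (hS : IsMulticone S) : IsClosed S := by
  obtain ⟨-, k, a, b, -, -, rfl⟩ := hS
  exact isClosed_iUnion_of_finite fun j => isClosed_projInterval _ _

theorem IsMulticone.cone_nonempty {S : Set (ℙ ℝ Plane)} (hS : IsMulticone S) :
    (cone S).Nonempty := by
  obtain ⟨-, k, a, b, hk, hab, rfl⟩ := hS
  have h0 : (!₂[Real.cos (a ⟨0, hk⟩), Real.sin (a ⟨0, hk⟩)] : Plane) ≠ 0 := by
    intro h
    have hc : Real.cos (a ⟨0, hk⟩) = 0 := by simpa using congrArg (fun x : Plane => x 0) h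
    have hs : Real.sin (a ⟨0, hk⟩) = 0 := by simpa using congrArg (fun x : Plane => x 1) h
    have h2 := Real.cos_sq_add_sin_sq (a ⟨0, hk⟩)
    rw [hc, hs] at h2
    norm_num at h2
  refine ⟨_, h0, Set.mem_iUnion.2 ⟨⟨0, hk⟩, a ⟨0, hk⟩, ⟨le_rfl, (hab _).le⟩, ?_⟩⟩
  rw [Projectivization.submodule_mk]
  exact Submodule.mem_span_singleton_self _

/-- The complement of a multicone contains two different lines. -/
theorem IsMulticone.exists_wedge_ne_zero {S : Set (ℙ ℝ Plane)} (hS : IsMulticone S) :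
    ∃ y₁ ∈ cone Sᶜ, ∃ y₂ ∈ cone Sᶜ, wedge y₁ y₂ ≠ 0 := by
  obtain ⟨V, hV⟩ := (Set.ne_univ_iff_exists_notMem S).1 hS.1
  have hy : V.rep ∈ cone Sᶜ := ⟨V.rep_nonzero, by rwa [Projectivization.mk_rep]⟩
  refine ⟨V.rep, hy, ?_⟩
  -- The complement of a multicone is open, so a missed line may be rotated slightly.
  have hc : ContinuousAt (fun t : ℝ => V.rep + t • rot V.rep) 0 := by fun_prop
  have h1 : ∀ᶠ t : ℝ in 𝓝 0, V.rep + t • rot V.rep ∈ cone Sᶜ :=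
    hc.eventually_mem ((isOpen_cone hS.isClosed.isOpen_compl).mem_nhds (by simpa using hy))
  have h2 : ∀ᶠ t : ℝ in 𝓝[≠] 0, V.rep + t • rot V.rep ∈ cone Sᶜ ∧ t ≠ 0 :=
    (h1.filter_mono nhdsWithin_le_nhds).and self_mem_nhdsWithin
  obtain ⟨t, ht, ht0⟩ := h2.exists
  refine ⟨_, ht, ?_⟩
  have : wedge V.rep (V.rep + t • rot V.rep) = t * ‖V.rep‖ ^ 2 := by
    rw [← wedge_rot]; simp [wedge]; ring
  rw [this]
  exact mul_ne_zero ht0 (by simpa using V.rep_nonzero)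

/-! ### Strongly invariant multicones -/

section Invariant

variable {N : ℕ} {A : Fin N → GL (Fin 2) ℝ} {S : Set (ℙ ℝ Plane)}

theorem IsStronglyInvariantMulticone.linMap_mem (hS : IsStronglyInvariantMulticone A S)
    (i : Fin N) {x : Plane} (hx : x ∈ cone S) : linMap (A i) x ∈ cone (interior S) :=
  cone_mono (hS.2 i) (linMap_mem_cone_image _ hx)

theorem IsStronglyInvariantMulticone.wordProd_mem (hS : IsStronglyInvariantMulticone A S)
    (w : List (Fin N)) {x : Plane} (hx : x ∈ cone S) : linMap (wordProd A w) x ∈ cone S := by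
  induction w with
  | nil => rwa [wordProd_nil, linMap_one]
  | cons a w ih =>
    rw [← List.singleton_append, wordProd_append, linMap_mul, wordProd_singleton]
    exact cone_mono interior_subset (hS.linMap_mem a ih)

/-- The images of a strongly invariant multicone are transversal to the complement of its
interior. -/
theorem IsStronglyInvariantMulticone.exists_le_wedge (hS : IsStronglyInvariantMulticone A S) :
    ∃ d : ℝ, 0 < d ∧ ∀ (i : Fin N) (x y : Plane), x ∈ cone S → y ∉ cone (interior S) →
      d * ‖y‖ * ‖linMap (A i) x‖ ≤ |wedge y (linMap (A i) x)| := by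
  have h1 (i : Fin N) : ∃ d : ℝ, 0 < d ∧ ∀ x y : Plane, x ∈ cone S → y ∉ cone (interior S) →
      d * ‖y‖ * ‖linMap (A i) x‖ ≤ |wedge y (linMap (A i) x)| := by
    -- Compactness on unit vectors: the area vanishes only if y is parallel to A_i x, which lies in
    -- the interior cone that y avoids. Homogeneity then gives all vectors, at the cost of a factor
    -- ‖A_i‖.
    obtain ⟨d, hd, h⟩ := ((isCompact_sphere_diff_cone (isOpen_interior (s := S))).prod
      (isCompact_sphere_inter_cone hS.1.isClosed)).exists_forall_le'
      (f := fun p : Plane × Plane => |wedge p.1 (linMap (A i) p.2)|) (a := 0)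
      (by
        have : Continuous fun p : Plane × Plane => (p.1, linMap (A i) p.2) := by fun_prop
        exact (continuous_abs.comp (continuous_wedge.comp this)).continuousOn)
      (by
        rintro ⟨y, x⟩ ⟨⟨hy, hy'⟩, hx, hx'⟩
        refine abs_pos.2 fun h0 => hy' ?_
        refine mem_cone_of_wedge_eq_zero (hS.linMap_mem i hx')
          (by rintro rfl; simp at hy) ?_
        have : wedge (linMap (A i) x) y = -wedge y (linMap (A i) x) := by simp [wedge]; ring
        rw [this, h0, neg_zero])
    refine ⟨d / ‖linMap (A i)‖, div_pos hd (norm_linMap_pos _), fun x y hx hy => ?_⟩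
    rcases eq_or_ne y 0 with rfl | hy0
    · simp
    have hx0 := hx.1
    have hxp := norm_pos_iff.2 hx0
    have hyp := norm_pos_iff.2 hy0
    have h2 := h (‖y‖⁻¹ • y, ‖x‖⁻¹ • x) ⟨⟨by simp [norm_smul, hyp.ne'], fun hc => hy (by
        have := smul_mem_cone hc hyp.ne'
        rwa [smul_smul, mul_inv_cancel₀ hyp.ne', one_smul] at this)⟩,
      ⟨by simp [norm_smul, hxp.ne'], smul_mem_cone hx (inv_ne_zero hxp.ne')⟩⟩
    simp only [map_smul, wedge_smul_left, wedge_smul_right, abs_mul, abs_inv, abs_norm] at h2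
    have h3 : d * ‖y‖ * ‖x‖ ≤ |wedge y (linMap (A i) x)| := by
      have h4 := mul_le_mul_of_nonneg_right h2 (mul_pos hyp hxp).le
      calc d * ‖y‖ * ‖x‖ = d * (‖y‖ * ‖x‖) := by ring
        _ ≤ _ := h4
        _ = _ := by field_simp
    have h4 := (linMap (A i)).le_opNorm x
    have h5 := norm_linMap_pos (A i)
    calc d / ‖linMap (A i)‖ * ‖y‖ * ‖linMap (A i) x‖
        ≤ d / ‖linMap (A i)‖ * ‖y‖ * (‖linMap (A i)‖ * ‖x‖) := by gcongr
      _ = d * ‖y‖ * ‖x‖ := by field_simp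
      _ ≤ _ := h3
  choose d hd h using h1
  rcases isEmpty_or_nonempty (Fin N) with hN | hN
  · exact ⟨1, one_pos, fun i => (hN.false i).elim⟩
  obtain ⟨i, hi⟩ := Finite.exists_min d
  refine ⟨d i, hd i, fun j x y hx hy => le_trans ?_ (h j x y hx hy)⟩
  have := hi j
  gcongr

/-- Matrix products expand a strongly invariant multicone at the maximal rate. -/
theorem IsStronglyInvariantMulticone.exists_alpha1_le (hS : IsStronglyInvariantMulticone A S) :
    ∃ c : ℝ, 0 < c ∧ ∀ (i : Fin N) (x : Plane) (u : List (Fin N)), x ∈ cone S →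
      c * alpha1 A u * ‖linMap (A i) x‖ ≤ ‖linMap (wordProd A u) (linMap (A i) x)‖ := by
  obtain ⟨d, hd, hwd⟩ := hS.exists_le_wedge
  obtain ⟨y₁, hy₁, y₂, hy₂, hy⟩ := hS.1.exists_wedge_ne_zero
  set ω := |wedge y₁ y₂| with hω
  have hωp : 0 < ω := abs_pos.2 hy
  have hn₁ := norm_pos_iff.2 hy₁.1
  have hn₂ := norm_pos_iff.2 hy₂.1
  refine ⟨d * ω / (2 * ‖y₁‖ * ‖y₂‖), by positivity, fun i x u hx => ?_⟩
  set z := linMap (A i) x with hz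
  set U := wordProd A u with hU
  have hD := absDet_pos U
  -- Since U preserves the cone, U⁻¹ preserves its complement. Hence U⁻¹y is transversal to z, and
  -- applying U turns this into a bound for ‖U⁻¹y‖ by ‖Uz‖.
  have step (y : Plane) (hy : y ∈ cone Sᶜ) :
      absDet U * (d * ‖linMap U⁻¹ y‖ * ‖z‖) ≤ ‖y‖ * ‖linMap U z‖ := by
    have hne : linMap U⁻¹ y ∉ cone (interior S) := by
      intro h
      have := hS.wordProd_mem u (cone_mono interior_subset h)
      rw [← hU, linMap_apply_inv] at this
      exact (mem_cone_compl hy.1).1 hy this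
    calc absDet U * (d * ‖linMap U⁻¹ y‖ * ‖z‖) ≤ absDet U * |wedge (linMap U⁻¹ y) z| :=
          mul_le_mul_of_nonneg_left (hwd i x _ hx hne) hD.le
      _ = |wedge y (linMap U z)| := by
          rw [absDet, ← abs_mul, ← wedge_linMap, linMap_apply_inv]
      _ ≤ _ := abs_wedge_le _ _
  have h1 := step y₁ hy₁
  have h2 := step y₂ hy₂
  set Q := d⁻¹ * (absDet U)⁻¹ * ‖linMap U z‖ with hQ
  have hQ0 : 0 ≤ Q := by positivity
  -- The vectors y₁, y₂ form a basis, so bounds on their images control ‖U⁻¹‖, which equals ‖U‖/|det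
  -- U|.
  have hop : ‖linMap U⁻¹‖ * ‖z‖ ≤ 2 * ‖y₁‖ * ‖y₂‖ / ω * Q := by
    have b1 : ‖linMap U⁻¹ y₁‖ * ‖z‖ ≤ ‖y₁‖ * Q := by
      rw [hQ]; field_simp; linarith
    have b2 : ‖linMap U⁻¹ y₂‖ * ‖z‖ ≤ ‖y₂‖ * Q := by
      rw [hQ]; field_simp; linarith
    rcases (norm_nonneg z).eq_or_lt with hz0 | hz0
    · rw [← hz0, mul_zero]; positivity
    rw [← le_div_iff₀ hz0]
    refine ContinuousLinearMap.opNorm_le_bound _ (by positivity) fun t => ?_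
    have e := congrArg (fun t => ‖linMap U⁻¹ t‖) (wedge_smul_eq t y₁ y₂)
    simp only [map_smul, map_add, norm_smul, Real.norm_eq_abs, ← hω] at e
    have e2 : ω * ‖linMap U⁻¹ t‖ ≤
        ‖t‖ * ‖y₂‖ * ‖linMap U⁻¹ y₁‖ + ‖y₁‖ * ‖t‖ * ‖linMap U⁻¹ y₂‖ := by
      rw [e]
      refine (norm_add_le _ _).trans ?_
      rw [norm_smul, norm_smul, Real.norm_eq_abs, Real.norm_eq_abs]
      gcongr
      · exact abs_wedge_le _ _
      · exact abs_wedge_le _ _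
    rw [div_mul_eq_mul_div, le_div_iff₀ hz0, div_mul_eq_mul_div, div_mul_eq_mul_div,
      le_div_iff₀ hωp]
    calc ‖linMap U⁻¹ t‖ * ‖z‖ * ω = (ω * ‖linMap U⁻¹ t‖) * ‖z‖ := by ring
      _ ≤ (‖t‖ * ‖y₂‖ * ‖linMap U⁻¹ y₁‖ + ‖y₁‖ * ‖t‖ * ‖linMap U⁻¹ y₂‖) * ‖z‖ := by gcongr
      _ = ‖t‖ * ‖y₂‖ * (‖linMap U⁻¹ y₁‖ * ‖z‖) + ‖y₁‖ * ‖t‖ * (‖linMap U⁻¹ y₂‖ * ‖z‖) := by ring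
      _ ≤ ‖t‖ * ‖y₂‖ * (‖y₁‖ * Q) + ‖y₁‖ * ‖t‖ * (‖y₂‖ * Q) := by gcongr
      _ = _ := by ring
  rw [norm_linMap_inv, hQ] at hop
  change ‖linMap (wordProd A u)‖ / _ * _ ≤ _ at hop
  change _ * ‖linMap (wordProd A u)‖ * _ ≤ _
  rw [← hU] at hop ⊢
  field_simp at hop ⊢
  linarith

/-- The preceding bound needs a vector already moved by one matrix. The last letter of u, which acts
first, provides it and costs a bounded factor; the minimum with 1 covers the empty word. -/
theorem IsStronglyInvariantMulticone.exists_alpha1_le_of_mem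
    (hS : IsStronglyInvariantMulticone A S) (hcontr : ∀ i, ‖linMap (A i)‖ < 1) :
    ∃ c : ℝ, 0 < c ∧ ∀ (x : Plane) (u : List (Fin N)), x ∈ cone S →
      c * alpha1 A u * ‖x‖ ≤ ‖linMap (wordProd A u) x‖ := by
  obtain ⟨c, hc, h⟩ := hS.exists_alpha1_le
  obtain ⟨k, hk, hk1, hka⟩ := exists_pow_le_alpha2 A
  obtain ⟨l, hl, hl1, hla⟩ := exists_alpha1_le_pow A hcontr
  refine ⟨min 1 (c * k), by positivity, fun x u hx => ?_⟩
  rcases List.eq_nil_or_concat u with rfl | ⟨u, i, rfl⟩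
  · rw [alpha1_nil, wordProd_nil, linMap_one, mul_one]
    exact mul_le_of_le_one_left (norm_nonneg _) (min_le_left _ _)
  rw [List.concat_eq_append]
  have h1 := h i x u hx
  have h2 : k ≤ alpha2 A [i] := by simpa using hka [i]
  have h3 := alpha2_mul_norm_le A [i] x
  have h4 : alpha1 A (u ++ [i]) ≤ alpha1 A u :=
    (alpha1_append_le A u [i]).trans (mul_le_of_le_one_right (alpha1_pos A u).le
      ((hla [i]).trans (by simpa using hl1.le)))
  have h5 := alpha1_pos A u
  rw [wordProd_append, linMap_mul]
  rw [wordProd_singleton] at h3 ⊢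
  calc min 1 (c * k) * alpha1 A (u ++ [i]) * ‖x‖ ≤ c * k * alpha1 A u * ‖x‖ := by
        gcongr
        · exact (alpha1_pos A _).le
        · exact min_le_right 1 (c * k)
    _ = c * alpha1 A u * (k * ‖x‖) := by ring
    _ ≤ c * alpha1 A u * ‖linMap (A i) x‖ := by
        gcongr
        exact le_trans (by gcongr) h3
    _ ≤ _ := h1

end Invariant

/-! ### Contracted Furstenberg directions -/

section Furstenberg

variable {N : ℕ} {A : Fin N → GL (Fin 2) ℝ}

/-- Normalize the image under A_w⁻¹ of a vector realizing at least half of ‖A_w⁻¹‖. -/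
theorem exists_norm_le_two_mul_alpha2 (A : Fin N → GL (Fin 2) ℝ) (w : List (Fin N)) :
    ∃ x : Plane, ‖x‖ = 1 ∧ ‖linMap (wordProd A w) x‖ ≤ 2 * alpha2 A w := by
  have hp := norm_linMap_pos (wordProd A w)⁻¹
  obtain ⟨x, hx1, hx⟩ := (linMap (wordProd A w)⁻¹).exists_lt_apply_of_lt_opNorm (half_lt_self hp)
  have hy : 0 < ‖linMap (wordProd A w)⁻¹ x‖ := (half_pos hp).trans hx
  refine ⟨‖linMap (wordProd A w)⁻¹ x‖⁻¹ • linMap (wordProd A w)⁻¹ x, ?_, ?_⟩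
  · rw [norm_smul, norm_inv, norm_norm, inv_mul_cancel₀ hy.ne']
  · rw [map_smul, linMap_apply_inv, norm_smul, norm_inv, norm_norm, alpha2, ← div_eq_mul_inv,
      inv_mul_le_iff₀ hy, mul_div_assoc', le_div_iff₀ hp]
    nlinarith

/-- A limit of almost most contracted directions of words with unboundedly many letters prepended
avoids every strongly invariant multicone. -/
theorem IsStronglyInvariantMulticone.notMem_of_tendsto {S : Set (ℙ ℝ Plane)}
    (hS : IsStronglyInvariantMulticone A S) (hcontr : ∀ i, ‖linMap (A i)‖ < 1)
    (hdom : IsDominated A) (s : List (Fin N)) (D : ℕ → List (Fin N)) (x : ℕ → Plane) (x₀ : Plane)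
    (hD : Tendsto (fun k => (D k).length) atTop atTop) (hx : Tendsto x atTop (𝓝 x₀))
    (hx1 : ∀ k, ‖x k‖ = 1)
    (hxc : ∀ᶠ k in atTop, ‖linMap (wordProd A (D k ++ s)) (x k)‖ ≤ 2 * alpha2 A (D k ++ s)) :
    linMap (wordProd A s) x₀ ∉ cone (interior S) := by
  intro hmem
  obtain ⟨c, hc, hcS⟩ := hS.exists_alpha1_le_of_mem hcontr
  obtain ⟨C, t, hC, ht, ht1, hCt⟩ := hdom
  obtain ⟨l, hl, hl1, hla⟩ := exists_alpha1_le_pow A hcontr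
  have h1 : ∀ᶠ k in atTop, linMap (wordProd A s) (x k) ∈ cone (interior S) :=
    (((linMap (wordProd A s)).continuous.tendsto x₀).comp hx).eventually
      ((isOpen_cone isOpen_interior).mem_nhds hmem)
  -- If A_s x₀ were in the open cone, then so would A_s x_k be for large k, and D k would expand it
  -- at rate α₁. But x_k is contracted at rate α₂, which domination makes exponentially smaller.
  have h2 : ∀ᶠ k in atTop, c * alpha2 A s ≤ 2 * C * t ^ (D k).length := by
    filter_upwards [h1, hxc] with k hk hk2
    have e1 := hcS _ (D k) (cone_mono interior_subset hk)
    have e2 := alpha2_mul_norm_le A s (x k)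
    rw [hx1, mul_one] at e2
    have e3 := hCt (D k ++ s)
    have e4 : alpha1 A (D k ++ s) ≤ alpha1 A (D k) :=
      (alpha1_append_le A _ s).trans (mul_le_of_le_one_right (alpha1_pos A _).le
        ((hla s).trans (pow_le_one₀ hl.le hl1.le)))
    rw [wordProd_append, linMap_mul] at hk2
    have e5 : t ^ (D k ++ s).length ≤ t ^ (D k).length :=
      pow_le_pow_of_le_one ht.le ht1.le (by simp)
    have e6 := alpha1_pos A (D k)
    have e7 := alpha1_pos A (D k ++ s)
    refine le_of_mul_le_mul_right ?_ e6
    calc c * alpha2 A s * alpha1 A (D k) = c * alpha1 A (D k) * alpha2 A s := by ring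
      _ ≤ c * alpha1 A (D k) * ‖linMap (wordProd A s) (x k)‖ := by gcongr
      _ ≤ 2 * alpha2 A (D k ++ s) := e1.trans hk2
      _ ≤ 2 * (C * t ^ (D k ++ s).length * alpha1 A (D k ++ s)) := by gcongr
      _ ≤ 2 * (C * t ^ (D k).length * alpha1 A (D k)) := by gcongr
      _ = _ := by ring
  have h3 : Tendsto (fun k => 2 * C * t ^ (D k).length) atTop (𝓝 (2 * C * 0)) :=
    ((tendsto_pow_atTop_nhds_zero_of_lt_one ht.le ht1).comp hD).const_mul _
  have h4 := ge_of_tendsto h3 h2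
  rw [mul_zero] at h4
  exact absurd h4 (not_le.2 (mul_pos hc (alpha2_pos A s)))

/-- Every word contracts some Furstenberg direction at the rate of its smaller singular value. -/
theorem exists_furstenbergDirection_contracted [Nonempty (Fin N)]
    (hcontr : ∀ i, ‖linMap (A i)‖ < 1) (hdom : IsDominated A) :
    ∃ K : ℝ, 0 < K ∧ ∀ w : List (Fin N), ∃ V ∈ furstenbergDirections A, ∃ x ∈ V.submodule,
      ‖x‖ = 1 ∧ ‖linMap (wordProd A w) x‖ ≤ K * alpha2 A w := by
  have hne {x : Plane} (hx : ‖x‖ = 1) : x ≠ 0 := by rintro rfl; simp at hx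
  by_cases hex : ∃ S, IsStronglyInvariantMulticone A S
  swap
  -- Without a strongly invariant multicone, `furstenbergDirections` is an intersection over an
  -- empty family, so every line qualifies.
  · refine ⟨2, two_pos, fun w => ?_⟩
    obtain ⟨x, hx, hxw⟩ := exists_norm_le_two_mul_alpha2 A w
    refine ⟨Projectivization.mk ℝ x (hne hx), ?_, x, ?_, hx, hxw⟩
    · exact Set.mem_iInter₂.2 fun S hS => (hex ⟨S, hS⟩).elim
    · rw [Projectivization.submodule_mk]
      exact Submodule.mem_span_singleton_self _
  obtain ⟨S₀, hS₀⟩ := hex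
  obtain ⟨c, hc, hcS⟩ := hS₀.exists_alpha1_le
  obtain ⟨d, hd, hdS⟩ := hS₀.exists_le_wedge
  obtain ⟨x₀, hx₀⟩ := hS₀.1.cone_nonempty
  obtain ⟨a⟩ := ‹Nonempty (Fin N)›
  refine ⟨(d * c)⁻¹, by positivity, fun w => ?_⟩
  -- The most contracted directions of w itself need not be in X_F. Prepending ever more letters and
  -- passing to a limit of almost most contracted directions gives an exact Furstenberg direction.
  set W : ℕ → List (Fin N) := fun k => List.replicate k a ++ w with hW
  choose y hy hyW using fun k => exists_norm_le_two_mul_alpha2 A (W k)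
  obtain ⟨x, hx, φ, hφ, hlim⟩ := (isCompact_sphere (0 : Plane) 1).tendsto_subseq
    (x := y) (fun k => by simp [hy])
  have hx1 : ‖x‖ = 1 := by simpa using hx
  -- Every suffix s of every W n is also a suffix of W (φ k) for large k, with an unboundedly long
  -- remainder in front. The same x serves all multicones S at once.
  have avoid (S : Set (ℙ ℝ Plane)) (hS : IsStronglyInvariantMulticone A S) (n : ℕ)
      (D s : List (Fin N)) (hDs : W n = D ++ s) :
      linMap (wordProd A s) x ∉ cone (interior S) := by
    refine hS.notMem_of_tendsto hcontr hdom s (fun k => List.replicate (φ k - n) a ++ D)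
      (y ∘ φ) x ?_ hlim (fun k => hy _) ?_
    · refine tendsto_atTop_mono (fun k => ?_) (tendsto_sub_atTop_nat n)
      have := hφ.id_le k
      simp only [List.length_append, List.length_replicate]
      simp only [id] at this
      omega
    · filter_upwards [eventually_ge_atTop n] with k hk
      have : List.replicate (φ k - n) a ++ D ++ s = W (φ k) := by
        rw [List.append_assoc, ← hDs, hW]
        simp only
        rw [← List.append_assoc, List.replicate_append_replicate,
          Nat.sub_add_cancel (hk.trans (hφ.id_le k))]
      rw [this]
      exact hyW _
  refine ⟨Projectivization.mk ℝ x (hne hx1), ?_, x, ?_, hx1, ?_⟩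
  · refine Set.mem_iInter₂.2 fun S hS => Set.mem_iInter₂.2 fun n _ => ?_
    -- The suffix of length n of W n: A_s x avoids the interior of S, so x lies in A_s⁻¹ of the
    -- closed complement, as the n-th level of X_F asks.
    set s := (W n).drop w.length with hs
    have hlen : s.reverse.length = n := by simp [hs, hW]
    obtain ⟨u, hu⟩ : ∃ u : Fin n → Fin N, List.ofFn u = s.reverse := by
      clear_value s
      subst hlen
      exact ⟨_, List.ofFn_get _⟩
    refine Set.mem_iUnion.2 ⟨u, ?_⟩
    rw [hu, List.reverse_reverse, closure_compl]
    have h1 := avoid S hS n _ s (List.take_append_drop w.length _).symm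
    refine ⟨Projectivization.mk ℝ (linMap (wordProd A s) x) (linMap_ne_zero _ (hne hx1)),
      fun h => h1 ⟨_, h⟩, ?_⟩
    rw [lineMap, Projectivization.map_mk]
    congr 1
    exact linMap_inv_apply _ _
  · rw [Projectivization.submodule_mk]
    exact Submodule.mem_span_singleton_self _
  -- The contraction rate survives the limit by transversality: A_w x avoids the interior cone while
  -- A_w z lies in an image of the multicone and has length at least about α₁(w)‖z‖. Their area is
  -- α₁α₂|x ∧ z|, which forces ‖A_w x‖ to be of order α₂.
  · have h1 := avoid S₀ hS₀ 0 [] w (by simp [hW])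
    set z := linMap (A a) x₀ with hz
    have hzp : 0 < ‖z‖ := norm_pos_iff.2 (linMap_ne_zero _ hx₀.1)
    obtain ⟨i, x', hx', hi⟩ : ∃ i, ∃ x' ∈ cone S₀, linMap (wordProd A w) z = linMap (A i) x' := by
      rcases w with _ | ⟨i, w⟩
      · exact ⟨a, x₀, hx₀, by rw [wordProd_nil, linMap_one]⟩
      · refine ⟨i, linMap (wordProd A w) z, hS₀.wordProd_mem w
          (cone_mono interior_subset (hS₀.linMap_mem a hx₀)), ?_⟩
        rw [← List.singleton_append, wordProd_append, linMap_mul, wordProd_singleton]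
    have h2 := hdS i x' _ hx' h1
    rw [← hi, wedge_linMap, abs_mul] at h2
    have h3 := hcS a x₀ w hx₀
    have h4 := abs_wedge_le x z
    rw [hx1, one_mul] at h4
    have h5 := alpha1_pos A w
    have h6 : |(wordProd A w : Matrix (Fin 2) (Fin 2) ℝ).det| = alpha1 A w * alpha2 A w :=
      (alpha1_mul_alpha2 A w).symm
    rw [h6] at h2
    rw [← hz] at h3
    have h7 := alpha2_pos A w
    rw [le_inv_mul_iff₀ (by positivity)]
    refine le_of_mul_le_mul_right ?_ (mul_pos h5 hzp)
    calc d * c * ‖linMap (wordProd A w) x‖ * (alpha1 A w * ‖z‖)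
        = d * ‖linMap (wordProd A w) x‖ * (c * alpha1 A w * ‖z‖) := by ring
      _ ≤ d * ‖linMap (wordProd A w) x‖ * ‖linMap (wordProd A w) z‖ := by gcongr
      _ ≤ alpha1 A w * alpha2 A w * |wedge x z| := h2
      _ ≤ alpha1 A w * alpha2 A w * ‖z‖ := by gcongr
      _ = _ := by ring

end Furstenberg

/-! ### Cylinders -/

section Cylinders

variable {N : ℕ}

@[simp] theorem length_pre (i : ℕ → Fin N) (n : ℕ) : (pre i n).length = n := by simp [pre]

theorem mem_wordCylinder_pre {i j : ℕ → Fin N} {n : ℕ} :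
    j ∈ wordCylinder (pre i n) ↔ ∀ k < n, j k = i k := by
  rw [wordCylinder, Set.mem_ofPred_eq, length_pre, pre, pre, List.ofFn_inj, funext_iff]
  exact ⟨fun h k hk => h ⟨k, hk⟩, fun h k => h k k.2⟩

theorem self_mem_wordCylinder_pre (i : ℕ → Fin N) (n : ℕ) : i ∈ wordCylinder (pre i n) :=
  mem_wordCylinder_pre.2 fun _ _ => rfl

theorem wordCylinder_ofFn {n : ℕ} (w : Fin n → Fin N) :
    wordCylinder (List.ofFn w) = (fun (i : ℕ → Fin N) (k : Fin n) => i k) ⁻¹' {w} := by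
  ext i
  rw [wordCylinder, Set.mem_ofPred_eq, List.length_ofFn, pre, List.ofFn_inj]
  rfl

theorem exists_ofFn_eq (w : List (Fin N)) : ∃ (n : ℕ) (u : Fin n → Fin N), List.ofFn u = w :=
  ⟨_, _, List.ofFn_get w⟩

theorem sum_measureReal_wordCylinder (μ : Measure (ℕ → Fin N)) [IsProbabilityMeasure μ] (n : ℕ) :
    ∑ w : Fin n → Fin N, μ.real (wordCylinder (List.ofFn w)) = 1 := by
  have : Measurable fun (i : ℕ → Fin N) (k : Fin n) => i k :=
    measurable_pi_lambda _ fun k => measurable_pi_apply _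
  simp only [wordCylinder_ofFn]
  rw [sum_measureReal_preimage_singleton _ fun y _ => this (MeasurableSet.singleton _)]
  simp

end Cylinders

/-! ### Pressure -/

section Pressure

variable {N : ℕ}

/-- The `n`-th partition sum of a potential. -/
def partitionSum (θ : List (Fin N) → ℝ) (n : ℕ) : ℝ := ∑ w : Fin n → Fin N, θ (List.ofFn w)

theorem partitionSum_add (θ : List (Fin N) → ℝ) (n m : ℕ) :
    partitionSum θ (n + m) =
      ∑ u : Fin n → Fin N, ∑ w : Fin m → Fin N, θ (List.ofFn u ++ List.ofFn w) := by
  rw [partitionSum, ← (Fin.appendEquiv n m).sum_comp, Fintype.sum_prod_type]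
  simp [Fin.appendEquiv, List.ofFn_fin_append]

theorem partitionSum_pos [Nonempty (Fin N)] {θ : List (Fin N) → ℝ} (hθ : ∀ w, 0 < θ w) (n : ℕ) :
    0 < partitionSum θ n :=
  Finset.sum_pos (fun _ _ => hθ _) Finset.univ_nonempty

theorem summable_of_summable_partitionSum {θ : List (Fin N) → ℝ} (hθ : ∀ w, 0 ≤ θ w)
    (h : Summable (partitionSum θ)) : Summable θ := by
  rw [← (List.equivSigmaTuple (α := Fin N)).symm.summable_iff]
  refine (summable_sigma_of_nonneg fun _ => hθ _).2 ?_
  refine ⟨fun n => Summable.of_finite, h.congr fun n => ?_⟩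
  rw [tsum_fintype]
  rfl

/-- Fekete's lemma for super-multiplicative potentials. -/
theorem exists_hasPressure [Nonempty (Fin N)] {θ : List (Fin N) → ℝ} (hθ : ∀ w, 0 < θ w) {c : ℝ}
    (hc : 0 < c) (hsup : ∀ u w, c * (θ u * θ w) ≤ θ (u ++ w)) {b : ℝ}
    (hb : ∀ n : ℕ, Real.log (partitionSum θ n) ≤ n * b) : ∃ p, HasPressure θ p := by
  have hZ := partitionSum_pos hθ
  have hsub : Subadditive fun n => -Real.log (c * partitionSum θ n) := by
    intro n m
    have h1 : (c * partitionSum θ n) * (c * partitionSum θ m) ≤ c * partitionSum θ (n + m) := by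
      rw [partitionSum_add]
      calc (c * partitionSum θ n) * (c * partitionSum θ m)
          = c * ∑ u : Fin n → Fin N, ∑ w : Fin m → Fin N,
              c * (θ (List.ofFn u) * θ (List.ofFn w)) := by
            simp only [partitionSum, ← Finset.mul_sum, ← Finset.sum_mul]
            ring
        _ ≤ _ := by
            refine mul_le_mul_of_nonneg_left ?_ hc.le
            exact Finset.sum_le_sum fun u _ => Finset.sum_le_sum fun w _ => hsup _ _
    have h2 := Real.log_le_log (mul_pos (mul_pos hc (hZ n)) (mul_pos hc (hZ m))) h1
    rw [Real.log_mul (mul_pos hc (hZ n)).ne' (mul_pos hc (hZ m)).ne'] at h2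
    linarith
  have hlog (n : ℕ) : Real.log (c * partitionSum θ n) = Real.log c + Real.log (partitionSum θ n) :=
    Real.log_mul hc.ne' (hZ n).ne'
  have hbdd : BddBelow (Set.range fun n : ℕ => -Real.log (c * partitionSum θ n) / n) := by
    -- The 0 covers n = 0, where the quotient is 0 by the convention for division by zero.
    refine ⟨min 0 (-(|Real.log c| + b)), ?_⟩
    rintro _ ⟨n, rfl⟩
    rcases n.eq_zero_or_pos with rfl | hn
    · simp
    refine (min_le_right _ _).trans ?_
    have hn' : (1 : ℝ) ≤ n := by exact_mod_cast hn
    simp only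
    rw [le_div_iff₀ (by linarith), hlog]
    have := hb n
    have h3 := le_abs_self (Real.log c)
    have h4 := abs_nonneg (Real.log c)
    nlinarith
  refine ⟨-hsub.lim, ?_⟩
  have h1 := (hsub.tendsto_lim hbdd).neg
  have h2 : Tendsto (fun n : ℕ => Real.log c / n) atTop (𝓝 0) :=
    tendsto_const_nhds.div_atTop tendsto_natCast_atTop_atTop
  have h3 := h1.sub h2
  rw [sub_zero] at h3
  refine h3.congr fun n => ?_
  rw [hlog, ← partitionSum]
  ring

/-- Half of the negative pressure is still an exponential rate, so the partition sums are eventually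
below a geometric sequence. -/
theorem summable_of_hasPressure_neg [Nonempty (Fin N)] {θ : List (Fin N) → ℝ} (hθ : ∀ w, 0 < θ w)
    {p : ℝ} (hp : HasPressure θ p) (hneg : p < 0) : Summable θ := by
  refine summable_of_summable_partitionSum (fun w => (hθ w).le) ?_
  have h1 : ∀ᶠ n : ℕ in atTop, ‖partitionSum θ n‖ ≤ Real.exp (p / 2) ^ n := by
    filter_upwards [hp.eventually_lt_const (show p < p / 2 by linarith),
      eventually_gt_atTop 0] with n hn hn0
    have hn' : (0 : ℝ) < n := by exact_mod_cast hn0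
    have hZ := partitionSum_pos hθ n
    rw [Real.norm_of_nonneg hZ.le, ← Real.exp_nat_mul, ← Real.log_le_iff_le_exp hZ]
    rw [← partitionSum, one_div, inv_mul_lt_iff₀ hn'] at hn
    exact hn.le
  exact Summable.of_norm_bounded_eventually_nat
    (summable_geometric_of_lt_one (Real.exp_pos _).le (Real.exp_lt_one_iff.2 (by linarith))) h1

/-! ### The potential of the spectrum -/

variable (A : Fin N → GL (Fin 2) ℝ)

/-- One formula for both branches: a submultiplicative norm and a multiplicative determinant, with
exponents that are 1-Lipschitz in s and nonnegative for s in [0, 2). -/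
theorem svf_eq {s : ℝ} (hs : s < 2) (w : List (Fin N)) :
    svf A s w = alpha1 A w ^ min s (2 - s) * absDet (wordProd A w) ^ max 0 (s - 1) := by
  have h1 := alpha1_pos A w
  have h2 := alpha2_pos A w
  rw [svf]
  split_ifs with h
  · rw [min_eq_left (by linarith), max_eq_left (by linarith), Real.rpow_zero, mul_one]
  · rw [min_eq_right (by linarith), max_eq_right (by linarith), ← alpha1_mul_alpha2,
      Real.mul_rpow h1.le h2.le, ← mul_assoc, ← Real.rpow_add h1,
      show 2 - s + (s - 1) = 1 by ring, Real.rpow_one]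

theorem svf_pos {s : ℝ} (hs : s < 2) (w : List (Fin N)) : 0 < svf A s w := by
  rw [svf_eq A hs]
  exact mul_pos (Real.rpow_pos_of_pos (alpha1_pos A w) _) (Real.rpow_pos_of_pos (absDet_pos _) _)

theorem svf_append_le {s : ℝ} (hs0 : 0 ≤ s) (hs : s < 2) (u w : List (Fin N)) :
    svf A s (u ++ w) ≤ svf A s u * svf A s w := by
  rw [svf_eq A hs, svf_eq A hs, svf_eq A hs, absDet_append,
    Real.mul_rpow (absDet_pos _).le (absDet_pos _).le]
  have h1 : alpha1 A (u ++ w) ^ min s (2 - s) ≤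
      alpha1 A u ^ min s (2 - s) * alpha1 A w ^ min s (2 - s) := by
    rw [← Real.mul_rpow (alpha1_pos A u).le (alpha1_pos A w).le]
    exact Real.rpow_le_rpow (alpha1_pos A _).le (alpha1_append_le A u w)
      (le_min hs0 (by linarith))
  have h2 := Real.rpow_nonneg (absDet_pos (wordProd A u)).le (max 0 (s - 1))
  have h3 := Real.rpow_nonneg (absDet_pos (wordProd A w)).le (max 0 (s - 1))
  calc _ ≤ alpha1 A u ^ min s (2 - s) * alpha1 A w ^ min s (2 - s) * _ :=
        mul_le_mul_of_nonneg_right h1 (mul_nonneg h2 h3)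
    _ = _ := by ring

/-- Changing the exponent changes the singular value function by an exponential factor. -/
theorem exists_svf_le (hcontr : ∀ i, ‖linMap (A i)‖ < 1) :
    ∃ M : ℝ, 0 ≤ M ∧ ∀ s s' : ℝ, s < 2 → s' < 2 → ∀ w : List (Fin N),
      svf A s w ≤ svf A s' w * Real.exp (w.length * (M * |s - s'|)) := by
  obtain ⟨k, hk, hk1, hka⟩ := exists_pow_le_alpha2 A
  obtain ⟨l, hl, hl1, hla⟩ := exists_alpha1_le_pow A hcontr
  have hL : 0 ≤ -Real.log k := by linarith [Real.log_nonpos hk.le hk1]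
  -- For a word of length n, -log α₁ is at most n(-log k) and -log |det| at most twice that, whence
  -- 3.
  refine ⟨3 * -Real.log k, by positivity, fun s s' hs hs' w => ?_⟩
  have h1 := alpha1_pos A w
  have h2 := alpha2_pos A w
  have h12 := alpha2_le_alpha1 A w
  have hle1 : Real.log (alpha1 A w) ≤ 0 :=
    Real.log_nonpos h1.le ((hla w).trans (pow_le_one₀ hl.le hl1.le))
  have hle2 : w.length * Real.log k ≤ Real.log (alpha2 A w) := by
    rw [← Real.log_pow]
    exact Real.log_le_log (pow_pos hk _) (hka w)
  have hle3 : Real.log (alpha2 A w) ≤ Real.log (alpha1 A w) := Real.log_le_log h2 h12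
  have hD : Real.log (absDet (wordProd A w)) = Real.log (alpha1 A w) + Real.log (alpha2 A w) := by
    rw [← alpha1_mul_alpha2, Real.log_mul h1.ne' h2.ne']
  have hlog (t : ℝ) (ht : t < 2) : Real.log (svf A t w) =
      min t (2 - t) * Real.log (alpha1 A w) +
        max 0 (t - 1) * Real.log (absDet (wordProd A w)) := by
    rw [svf_eq A ht, Real.log_mul (Real.rpow_pos_of_pos h1 _).ne'
      (Real.rpow_pos_of_pos (absDet_pos _) _).ne', Real.log_rpow h1, Real.log_rpow (absDet_pos _)]
  have ha : min s' (2 - s') - min s (2 - s) ≤ |s - s'| := by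
    rw [abs_sub_comm]
    have := abs_min_sub_min_le_max s' (2 - s') s (2 - s)
    rw [show 2 - s' - (2 - s) = -(s' - s) by ring, abs_neg, max_self] at this
    exact (le_abs_self _).trans this
  have hb : max 0 (s' - 1) - max 0 (s - 1) ≤ |s - s'| := by
    rw [abs_sub_comm]
    have := abs_max_sub_max_le_max 0 (s' - 1) 0 (s - 1)
    rw [show s' - 1 - (s - 1) = s' - s by ring, sub_self, abs_zero,
      max_eq_right (abs_nonneg (s' - s))] at this
    exact (le_abs_self _).trans this
  rw [← Real.log_le_log_iff (svf_pos A hs w) (mul_pos (svf_pos A hs' w) (Real.exp_pos _)),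
    Real.log_mul (svf_pos A hs' w).ne' (Real.exp_pos _).ne', Real.log_exp, hlog s hs, hlog s' hs']
  have e1 : (min s' (2 - s') - min s (2 - s)) * -Real.log (alpha1 A w) ≤
      |s - s'| * -Real.log (alpha1 A w) := mul_le_mul_of_nonneg_right ha (by linarith)
  have e2 : (max 0 (s' - 1) - max 0 (s - 1)) * -Real.log (absDet (wordProd A w)) ≤
      |s - s'| * -Real.log (absDet (wordProd A w)) := mul_le_mul_of_nonneg_right hb (by linarith)
  have e3 : |s - s'| * (-Real.log (alpha1 A w) + -Real.log (absDet (wordProd A w))) ≤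
      |s - s'| * (3 * (w.length * -Real.log k)) :=
    mul_le_mul_of_nonneg_left (by linarith) (abs_nonneg _)
  linarith

variable {A}
variable {μ : Measure (ℕ → Fin N)} [IsProbabilityMeasure μ] {q : ℝ}

theorem measureReal_wordCylinder_pos (hfull : IsFullySupported μ) (w : List (Fin N)) :
    0 < μ.real (wordCylinder w) := by
  rw [measureReal_def]
  exact ENNReal.toReal_pos (hfull w).ne' (measure_ne_top _ _)

theorem psi_pos (hfull : IsFullySupported μ) {s : ℝ} (hs : s < 2) (w : List (Fin N)) :
    0 < psi A μ q s w :=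
  mul_pos (Real.rpow_pos_of_pos (measureReal_wordCylinder_pos hfull w) _)
    (Real.rpow_pos_of_pos (svf_pos A hs w) _)

/-- As 1 - q < 0, submultiplicativity of the singular value function reverses; the measure factor
uses the lower quasi-Bernoulli bound. -/
theorem exists_mul_psi_le_psi_append (hfull : IsFullySupported μ) (hqB : IsQuasiBernoulli μ)
    (hq : 1 < q) : ∃ c : ℝ, 0 < c ∧ ∀ s : ℝ, 0 ≤ s → s < 2 → ∀ u w : List (Fin N),
      c * (psi A μ q s u * psi A μ q s w) ≤ psi A μ q s (u ++ w) := by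
  obtain ⟨C, hC, hqB⟩ := hqB
  have hC0 : 0 < C := one_pos.trans_le hC
  refine ⟨C⁻¹ ^ q, Real.rpow_pos_of_pos (inv_pos.2 hC0) _, fun s hs0 hs u w => ?_⟩
  have hu := measureReal_wordCylinder_pos hfull u
  have hw := measureReal_wordCylinder_pos hfull w
  have h1 : (C⁻¹ * (μ.real (wordCylinder u) * μ.real (wordCylinder w))) ^ q ≤
      μ.real (wordCylinder (u ++ w)) ^ q :=
    Real.rpow_le_rpow (by positivity) (hqB u w).1 (by linarith)
  have h2 : (svf A s u * svf A s w) ^ (1 - q) ≤ svf A s (u ++ w) ^ (1 - q) :=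
    Real.rpow_le_rpow_of_nonpos (svf_pos A hs _) (svf_append_le A hs0 hs u w) (by linarith)
  rw [Real.mul_rpow (inv_pos.2 hC0).le (mul_pos hu hw).le, Real.mul_rpow hu.le hw.le] at h1
  rw [Real.mul_rpow (svf_pos A hs u).le (svf_pos A hs w).le] at h2
  rw [psi, psi, psi]
  calc _ = (C⁻¹ ^ q * (μ.real (wordCylinder u) ^ q * μ.real (wordCylinder w) ^ q)) *
        (svf A s u ^ (1 - q) * svf A s w ^ (1 - q)) := by ring
    _ ≤ _ := mul_le_mul h1 h2 (mul_nonneg (Real.rpow_nonneg (svf_pos A hs u).le _)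
      (Real.rpow_nonneg (svf_pos A hs w).le _)) (Real.rpow_nonneg measureReal_nonneg _)

/-- After division by n the error is independent of n, so the pressure is Lipschitz in the exponent.
-/
theorem log_partitionSum_psi_le [Nonempty (Fin N)] (hfull : IsFullySupported μ) (hq : 1 < q)
    {M : ℝ} (hM : ∀ s s' : ℝ, s < 2 → s' < 2 → ∀ w : List (Fin N),
      svf A s w ≤ svf A s' w * Real.exp (w.length * (M * |s - s'|)))
    {s s' : ℝ} (hs : s < 2) (hs' : s' < 2) (n : ℕ) :
    Real.log (partitionSum (psi A μ q s) n) ≤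
      Real.log (partitionSum (psi A μ q s') n) + n * ((q - 1) * M * |s - s'|) := by
  have h1 (w : List (Fin N)) : psi A μ q s w ≤
      Real.exp (w.length * ((q - 1) * M * |s - s'|)) * psi A μ q s' w := by
    have h2 : (svf A s w * Real.exp (w.length * (M * |s' - s|))) ^ (1 - q) ≤
        svf A s' w ^ (1 - q) :=
      Real.rpow_le_rpow_of_nonpos (svf_pos A hs' _) (hM s' s hs' hs w) (by linarith)
    rw [Real.mul_rpow (svf_pos A hs w).le (Real.exp_pos _).le, ← Real.exp_mul] at h2
    have h3 : svf A s w ^ (1 - q) ≤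
        Real.exp (w.length * ((q - 1) * M * |s - s'|)) * svf A s' w ^ (1 - q) := by
      have h4 := mul_le_mul_of_nonneg_left h2
        (Real.exp_pos (w.length * ((q - 1) * M * |s - s'|))).le
      rw [mul_left_comm, ← Real.exp_add, abs_sub_comm s' s] at h4
      ring_nf at h4
      simp only [Real.exp_zero, mul_one] at h4
      ring_nf
      exact h4
    rw [psi, psi, mul_left_comm]
    exact mul_le_mul_of_nonneg_left h3 (Real.rpow_nonneg measureReal_nonneg _)
  have h2 : partitionSum (psi A μ q s) n ≤
      Real.exp (n * ((q - 1) * M * |s - s'|)) * partitionSum (psi A μ q s') n := by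
    rw [partitionSum, partitionSum, Finset.mul_sum]
    exact Finset.sum_le_sum fun w _ => by simpa using h1 (List.ofFn w)
  have h3 := Real.log_le_log (partitionSum_pos (psi_pos hfull hs) n) h2
  rw [Real.log_mul (Real.exp_pos _).ne' (partitionSum_pos (psi_pos hfull hs') n).ne',
    Real.log_exp] at h3
  linarith

theorem log_partitionSum_psi_zero_nonpos [Nonempty (Fin N)] (hfull : IsFullySupported μ)
    (hq : 1 < q) (n : ℕ) : Real.log (partitionSum (psi A μ q 0) n) ≤ 0 := by
  refine Real.log_nonpos (partitionSum_pos (psi_pos hfull two_pos) n).le ?_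
  rw [← sum_measureReal_wordCylinder μ n, partitionSum]
  refine Finset.sum_le_sum fun w _ => ?_
  rw [psi, svf, if_pos one_pos, Real.rpow_zero, Real.one_rpow, mul_one]
  exact Real.rpow_le_self_of_le_one measureReal_nonneg measureReal_le_one hq.le

/-- Below its zero the pressure is negative. -/
theorem exists_hasPressure_neg [Nonempty (Fin N)] (hcontr : ∀ i, ‖linMap (A i)‖ < 1)
    (hfull : IsFullySupported μ) (hqB : IsQuasiBernoulli μ) (hq : 1 < q) {s : ℝ} (hs0 : 0 ≤ s)
    (hs2 : s < 2) (hs : s < pressureZero A μ q) : ∃ p < 0, HasPressure (psi A μ q s) p := by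
  obtain ⟨M, hM0, hM⟩ := exists_svf_le A hcontr
  obtain ⟨c, hc, hsup⟩ := exists_mul_psi_le_psi_append (A := A) hfull hqB hq
  have hex (t : ℝ) (ht : t ∈ Set.Icc 0 s) : ∃ p, HasPressure (psi A μ q t) p := by
    refine exists_hasPressure (psi_pos hfull (ht.2.trans_lt hs2)) hc
      (hsup t ht.1 (ht.2.trans_lt hs2)) (b := (q - 1) * M * |t - 0|) fun n => ?_
    have := log_partitionSum_psi_le (μ := μ) hfull hq hM (ht.2.trans_lt hs2) two_pos n
    have h0 := log_partitionSum_psi_zero_nonpos (A := A) (μ := μ) hfull hq n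
    linarith
  choose! P hP using hex
  have hlip (t t' : ℝ) (ht : t ∈ Set.Icc 0 s) (ht' : t' ∈ Set.Icc 0 s) :
      P t ≤ P t' + (q - 1) * M * |t - t'| := by
    refine le_of_tendsto_of_tendsto (hP t ht) ((hP t' ht').add_const _) ?_
    filter_upwards [eventually_gt_atTop 0] with n hn
    have hn' : (0 : ℝ) < n := by exact_mod_cast hn
    have := log_partitionSum_psi_le (μ := μ) hfull hq hM (ht.2.trans_lt hs2) (ht'.2.trans_lt hs2) n
    rw [one_div, inv_mul_le_iff₀ hn', mul_add, mul_inv_cancel_left₀ hn'.ne']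
    exact this
  have hcont : ContinuousOn P (Set.Icc 0 s) := by
    have : LipschitzOnWith (Real.toNNReal ((q - 1) * M)) P (Set.Icc 0 s) := by
      refine LipschitzOnWith.of_le_add_mul _ fun t ht t' ht' => ?_
      rw [Real.coe_toNNReal _ (mul_nonneg (by linarith) hM0), Real.dist_eq]
      exact hlip t t' ht ht'
    exact this.continuousOn
  have hP0 : P 0 ≤ 0 := by
    refine le_of_tendsto (hP 0 ⟨le_rfl, hs0⟩) (Eventually.of_forall fun n => ?_)
    exact mul_nonpos_of_nonneg_of_nonpos (by positivity)
      (log_partitionSum_psi_zero_nonpos hfull hq n)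
  refine ⟨P s, ?_, hP s ⟨hs0, le_rfl⟩⟩
  by_contra! hPs
  -- A zero at or below s would contradict that `pressureZero` is the infimum of the zeros; neither
  -- monotonicity of the pressure nor uniqueness of the zero is needed.
  obtain ⟨t, ht, ht0⟩ := intermediate_value_Icc hs0 hcont ⟨hP0, hPs⟩
  have h1 : HasPressure (psi A μ q t) 0 := ht0 ▸ hP t ht
  have h2 : pressureZero A μ q ≤ t := csInf_le ⟨0, fun _ h => h.1⟩ ⟨ht.1, h1⟩
  linarith [ht.2]

theorem summable_measure_mul_alpha1 [Nonempty (Fin N)] (hcontr : ∀ i, ‖linMap (A i)‖ < 1)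
    (hfull : IsFullySupported μ) (hqB : IsQuasiBernoulli μ) (hq : 1 < q) {s : ℝ}
    (hs1 : s < 1) (hs : s < pressureZero A μ q) :
    Summable fun w : List (Fin N) => μ.real (wordCylinder w) ^ q * (alpha1 A w ^ s) ^ (1 - q) := by
  rcases le_or_gt 0 s with hs0 | hs0
  · obtain ⟨p, hp, h⟩ := exists_hasPressure_neg hcontr hfull hqB hq hs0 (by linarith) hs
    have := summable_of_hasPressure_neg (psi_pos hfull (by linarith)) h hp
    refine this.congr fun w => ?_
    rw [psi, svf, if_pos hs1]
  -- Negative exponents do occur, since T runs over all reals below τ. Then s(1-q) > 0, and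
  -- contraction together with μ([w])^q ≤ μ([w]) gives a geometric bound.
  · obtain ⟨l, hl, hl1, hla⟩ := exists_alpha1_le_pow A hcontr
    have he : 0 < s * (1 - q) := mul_pos_of_neg_of_neg hs0 (by linarith)
    have hnn (w : List (Fin N)) :
        0 ≤ μ.real (wordCylinder w) ^ q * (alpha1 A w ^ s) ^ (1 - q) :=
      mul_nonneg (Real.rpow_nonneg measureReal_nonneg _)
        (Real.rpow_nonneg (Real.rpow_nonneg (alpha1_pos A w).le _) _)
    refine summable_of_summable_partitionSum hnn ?_
    refine Summable.of_nonneg_of_le (fun n => Finset.sum_nonneg fun w _ => hnn _) (fun n => ?_)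
      (summable_geometric_of_lt_one (Real.rpow_nonneg hl.le (s * (1 - q)))
        (Real.rpow_lt_one hl.le hl1 he))
    have hsum : (l ^ (s * (1 - q))) ^ n = ∑ w : Fin n → Fin N,
        μ.real (wordCylinder (List.ofFn w)) * (l ^ (s * (1 - q))) ^ n := by
      rw [← Finset.sum_mul, sum_measureReal_wordCylinder, one_mul]
    rw [partitionSum, hsum]
    refine Finset.sum_le_sum fun w _ => ?_
    have h1 : (alpha1 A (List.ofFn w) ^ s) ^ (1 - q) ≤ (l ^ (s * (1 - q))) ^ n := by
      rw [← Real.rpow_mul (alpha1_pos A _).le, ← Real.rpow_natCast, ← Real.rpow_mul hl.le,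
        mul_comm _ (n : ℝ), Real.rpow_mul hl.le, Real.rpow_natCast]
      refine Real.rpow_le_rpow (alpha1_pos A _).le ?_ he.le
      simpa using hla (List.ofFn w)
    exact mul_le_mul (Real.rpow_le_self_of_le_one measureReal_nonneg measureReal_le_one hq.le) h1
      (Real.rpow_nonneg (Real.rpow_nonneg (alpha1_pos A _).le _) _) measureReal_nonneg

/-- For s ≥ 1 the summand is the potential itself. For s < 1 the formula with α₂ is no longer φ^s,
but α₂ ≤ α₁ makes it larger than α₁^s, and the power 1-q reverses this into a comparison with the
previous series. -/
theorem summable_measure_mul_alpha1_mul_alpha2 [Nonempty (Fin N)]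
    (hcontr : ∀ i, ‖linMap (A i)‖ < 1)
    (hfull : IsFullySupported μ) (hqB : IsQuasiBernoulli μ) (hq : 1 < q) {s : ℝ}
    (hs2 : s < 2) (hs : s < pressureZero A μ q) :
    Summable fun w : List (Fin N) =>
      μ.real (wordCylinder w) ^ q * (alpha1 A w * alpha2 A w ^ (s - 1)) ^ (1 - q) := by
  rcases le_or_gt 1 s with hs1 | hs1
  · obtain ⟨p, hp, h⟩ := exists_hasPressure_neg hcontr hfull hqB hq (by linarith) hs2 hs
    have := summable_of_hasPressure_neg (psi_pos hfull hs2) h hp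
    refine this.congr fun w => ?_
    rw [psi, svf, if_neg (by linarith), if_pos hs2]
  · refine Summable.of_nonneg_of_le (fun w => ?_) (fun w => ?_)
      (summable_measure_mul_alpha1 hcontr hfull hqB hq hs1 hs)
    · exact mul_nonneg (Real.rpow_nonneg measureReal_nonneg _)
        (Real.rpow_nonneg (mul_nonneg (alpha1_pos A w).le
          (Real.rpow_nonneg (alpha2_pos A w).le _)) _)
    · refine mul_le_mul_of_nonneg_left ?_ (Real.rpow_nonneg measureReal_nonneg _)
      refine Real.rpow_le_rpow_of_nonpos (Real.rpow_pos_of_pos (alpha1_pos A w) _) ?_ (by linarith)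
      have h1 : alpha1 A w ^ s = alpha1 A w * alpha1 A w ^ (s - 1) := by
        rw [Real.rpow_sub_one (alpha1_pos A w).ne', mul_div_cancel₀ _ (alpha1_pos A w).ne']
      rw [h1]
      exact mul_le_mul_of_nonneg_left (Real.rpow_le_rpow_of_nonpos (alpha2_pos A w)
        (alpha2_le_alpha1 A w) (by linarith)) (alpha1_pos A w).le

end Pressure

/-! ### Coding of the self-affine set -/

section Coding

variable {N : ℕ}

/-- The `n`-fold left shift. -/
def shift (n : ℕ) (i : ℕ → Fin N) : ℕ → Fin N := fun k => i (n + k)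

theorem pre_add (i : ℕ → Fin N) (n m : ℕ) : pre i (n + m) = pre i n ++ pre (shift n i) m := by
  rw [pre, List.ofFn_add]
  rfl

theorem pre_succ (i : ℕ → Fin N) (n : ℕ) : pre i (n + 1) = pre i n ++ [i n] := by
  rw [pre_add]
  simp [pre, shift]

theorem pre_eq_of_agree {i j : ℕ → Fin N} {n : ℕ} (h : ∀ k < n, j k = i k) : pre j n = pre i n := by
  rw [pre, pre, List.ofFn_inj]
  exact funext fun k => h k k.2

theorem continuous_truncate (n : ℕ) : Continuous fun (i : ℕ → Fin N) (k : Fin n) => i k :=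
  continuous_pi fun k => continuous_apply (k : ℕ)

theorem continuous_of_prefix (k : ℕ) (f : List (Fin N) → Fin N → Plane) :
    Continuous fun i : ℕ → Fin N => f (pre i k) (i k) := by
  have h1 : Continuous fun p : (Fin k → Fin N) × Fin N => f (List.ofFn p.1) p.2 :=
    continuous_of_discreteTopology
  exact h1.comp ((continuous_truncate k).prodMk (continuous_apply k))

variable (A : Fin N → GL (Fin 2) ℝ) (v : Fin N → Plane)

/-- The image of the origin under `φ_{i|ₙ}`. -/
noncomputable def partialProj (n : ℕ) (i : ℕ → Fin N) : Plane :=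
  ∑ k ∈ Finset.range n, linMap (wordProd A (pre i k)) (v (i k))

variable {A}

theorem exists_summable_bound (hcontr : ∀ i, ‖linMap (A i)‖ < 1) :
    ∃ b : ℕ → ℝ, Summable b ∧ ∀ (k : ℕ) (i : ℕ → Fin N),
      ‖linMap (wordProd A (pre i k)) (v (i k))‖ ≤ b k := by
  obtain ⟨l, hl, hl1, hla⟩ := exists_alpha1_le_pow A hcontr
  refine ⟨fun k => l ^ k * ∑ a, ‖v a‖,
    (summable_geometric_of_lt_one hl.le hl1).mul_right _, fun k i => ?_⟩
  refine (norm_linMap_le A _ _).trans (mul_le_mul ?_ ?_ (norm_nonneg _) (pow_pos hl _).le)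
  · simpa using hla (pre i k)
  · exact Finset.single_le_sum (f := fun a => ‖v a‖) (fun _ _ => norm_nonneg _) (Finset.mem_univ _)

theorem continuous_canonicalProj (hcontr : ∀ i, ‖linMap (A i)‖ < 1) :
    Continuous (canonicalProj A v) := by
  obtain ⟨b, hb, h⟩ := exists_summable_bound v hcontr
  exact continuous_tsum
    (fun k => continuous_of_prefix k fun u a => linMap (wordProd A u) (v a)) hb h

theorem hasSum_canonicalProj (hcontr : ∀ i, ‖linMap (A i)‖ < 1) (i : ℕ → Fin N) :
    HasSum (fun n : ℕ => linMap (wordProd A (pre i n)) (v (i n))) (canonicalProj A v i) := by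
  obtain ⟨b, hb, h⟩ := exists_summable_bound v hcontr
  exact (Summable.of_norm_bounded hb fun k => h k i).hasSum

theorem canonicalProj_eq (hcontr : ∀ i, ‖linMap (A i)‖ < 1) (i : ℕ → Fin N) (n : ℕ) :
    canonicalProj A v i =
      partialProj A v n i + linMap (wordProd A (pre i n)) (canonicalProj A v (shift n i)) := by
  have h1 := (hasSum_canonicalProj v hcontr i).summable.sum_add_tsum_nat_add n
  rw [canonicalProj, ← h1, partialProj, canonicalProj,
    (linMap (wordProd A (pre i n))).map_tsum (hasSum_canonicalProj v hcontr _).summable]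
  congr 1
  refine tsum_congr fun k => ?_
  rw [add_comm k n, pre_add, wordProd_append, linMap_mul]
  rfl

theorem partialProj_eq_of_agree {i j : ℕ → Fin N} {n : ℕ} (h : ∀ k < n, j k = i k) :
    partialProj A v n j = partialProj A v n i := by
  refine Finset.sum_congr rfl fun k hk => ?_
  rw [Finset.mem_range] at hk
  rw [h k hk, pre_eq_of_agree fun m hm => h m (hm.trans hk)]

theorem canonicalProj_sub (hcontr : ∀ i, ‖linMap (A i)‖ < 1) {i j : ℕ → Fin N} {n : ℕ}
    (h : ∀ k < n, j k = i k) :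
    canonicalProj A v j - canonicalProj A v i = linMap (wordProd A (pre i n))
      (canonicalProj A v (shift n j) - canonicalProj A v (shift n i)) := by
  rw [canonicalProj_eq v hcontr i n, canonicalProj_eq v hcontr j n, partialProj_eq_of_agree v h,
    pre_eq_of_agree h, map_sub]
  abel

theorem partialProj_succ_add (n : ℕ) (i : ℕ → Fin N) (x : Plane) :
    partialProj A v (n + 1) i + linMap (wordProd A (pre i (n + 1))) x =
      partialProj A v n i + linMap (wordProd A (pre i n)) (affMap A v (i n) x) := by
  rw [partialProj, Finset.sum_range_succ, ← partialProj, pre_succ, wordProd_append, linMap_mul,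
    wordProd_singleton, affMap, map_add]
  abel

variable {v} {X : Set Plane}

theorem tendsto_partialProj_add (hcontr : ∀ i, ‖linMap (A i)‖ < 1) (hX : IsCompact X)
    (i : ℕ → Fin N) {y : ℕ → Plane} (hy : ∀ n, y n ∈ X) :
    Tendsto (fun n => partialProj A v n i + linMap (wordProd A (pre i n)) (y n)) atTop
      (𝓝 (canonicalProj A v i)) := by
  obtain ⟨l, hl, hl1, hla⟩ := exists_alpha1_le_pow A hcontr
  obtain ⟨R, hR⟩ := hX.isBounded.exists_norm_le
  have h1 : Tendsto (fun n => linMap (wordProd A (pre i n)) (y n)) atTop (𝓝 0) := by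
    refine squeeze_zero_norm (a := fun n => l ^ n * R) (fun n => ?_) ?_
    · refine (norm_linMap_le A _ _).trans
        (mul_le_mul ?_ (hR _ (hy n)) (norm_nonneg _) (pow_pos hl _).le)
      simpa using hla (pre i n)
    · simpa using (tendsto_pow_atTop_nhds_zero_of_lt_one hl.le hl1).mul_const R
  have h2 := (hasSum_canonicalProj v hcontr i).tendsto_sum_nat.add h1
  rwa [add_zero] at h2

theorem IsSelfAffineSet.canonicalProj_mem (hX : IsSelfAffineSet A v X)
    (hcontr : ∀ i, ‖linMap (A i)‖ < 1) (i : ℕ → Fin N) : canonicalProj A v i ∈ X := by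
  obtain ⟨⟨x, hx⟩, hXc, hXeq⟩ := hX
  refine hXc.isClosed.mem_of_tendsto
    (tendsto_partialProj_add hcontr hXc i (y := fun _ => x) fun _ => hx)
    (Eventually.of_forall fun n => ?_)
  induction n generalizing x with
  | zero => simpa [partialProj, pre, wordProd_nil, linMap_one] using hx
  | succ n ih =>
    rw [partialProj_succ_add]
    refine ih _ ?_
    rw [hXeq]
    exact Set.mem_iUnion.2 ⟨i n, x, hx, rfl⟩

theorem IsSelfAffineSet.exists_canonicalProj_eq (hX : IsSelfAffineSet A v X)
    (hcontr : ∀ i, ‖linMap (A i)‖ < 1) {x : Plane} (hx : x ∈ X) :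
    ∃ i, canonicalProj A v i = x := by
  obtain ⟨-, hXc, hXeq⟩ := hX
  have h1 (y : X) : ∃ (a : Fin N) (z : X), affMap A v a z = y := by
    have h2 := y.2
    obtain ⟨a, z, hz, h⟩ := Set.mem_iUnion.1 (hXeq.subset h2)
    exact ⟨a, ⟨z, hz⟩, h⟩
  choose c g hg using h1
  -- The code of x is read off by choosing inverse branches repeatedly.
  set y : ℕ → X := fun n => g^[n] ⟨x, hx⟩ with hy
  set i : ℕ → Fin N := fun n => c (y n) with hi
  refine ⟨i, ?_⟩
  have h3 (n : ℕ) : partialProj A v n i + linMap (wordProd A (pre i n)) (y n) = x := by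
    induction n with
    | zero => simp [partialProj, pre, wordProd_nil, linMap_one, hy]
    | succ n ih =>
      rw [partialProj_succ_add, ← ih]
      congr 2
      have : y (n + 1) = g (y n) := Function.iterate_succ_apply' g n _
      rw [this, hi]
      exact hg (y n)
  have h4 := tendsto_partialProj_add (v := v) hcontr hXc i (y := fun n => y n) fun n => (y n).2
  simp only [h3] at h4
  exact tendsto_nhds_unique h4 tendsto_const_nhds

theorem exists_le_dist_affMap (hXc : IsCompact X) (hsep : StrongSeparation A v X) :
    ∃ d : ℝ, 0 < d ∧ ∀ a b : Fin N, a ≠ b → ∀ x ∈ X, ∀ y ∈ X,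
      d ≤ dist (affMap A v a x) (affMap A v b y) := by
  have h1 (p : Fin N × Fin N) : ∃ d : ℝ, 0 < d ∧ (p.1 ≠ p.2 → ∀ x ∈ X, ∀ y ∈ X,
      d ≤ dist (affMap A v p.1 x) (affMap A v p.2 y)) := by
    by_cases hp : p.1 = p.2
    · exact ⟨1, one_pos, fun h => (h hp).elim⟩
    obtain ⟨d, hd, h⟩ := (hXc.prod hXc).exists_forall_le' (a := (0 : ℝ))
      (f := fun z : Plane × Plane => dist (affMap A v p.1 z.1) (affMap A v p.2 z.2))
      (by unfold affMap; fun_prop)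
      (by
        rintro ⟨x, y⟩ ⟨hx, hy⟩
        refine dist_pos.2 fun h => ?_
        exact Set.disjoint_left.1 (hsep _ _ hp) ⟨x, hx, rfl⟩ ⟨y, hy, h.symm⟩)
    exact ⟨d, hd, fun _ x hx y hy => h (x, y) ⟨hx, hy⟩⟩
  choose d hd h using h1
  rcases isEmpty_or_nonempty (Fin N) with hN | hN
  · exact ⟨1, one_pos, fun a => (hN.false a).elim⟩
  obtain ⟨p, hp⟩ := Finite.exists_min d
  exact ⟨d p, hd p, fun a b hab x hx y hy => (hp (a, b)).trans (h (a, b) hab x hx y hy)⟩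

/-- Points in different cylinders are separated. -/
theorem exists_mul_alpha2_le_dist (hX : IsSelfAffineSet A v X)
    (hcontr : ∀ i, ‖linMap (A i)‖ < 1) (hsep : StrongSeparation A v X) :
    ∃ d : ℝ, 0 < d ∧ ∀ (i j : ℕ → Fin N) (n : ℕ), j ∉ wordCylinder (pre i n) →
      d * alpha2 A (pre i n) ≤ dist (canonicalProj A v j) (canonicalProj A v i) := by
  obtain ⟨d, hd, h⟩ := exists_le_dist_affMap hX.2.1 hsep
  obtain ⟨l, hl, hl1, hla⟩ := exists_alpha1_le_pow A hcontr
  refine ⟨d, hd, fun i j n hj => ?_⟩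
  rw [mem_wordCylinder_pre] at hj
  push Not at hj
  classical
  -- At the first disagreement k the shifted points lie in different first-level pieces; A_{i|k}
  -- shrinks their distance by at most α₂(i|k), which is at least α₂(i|n).
  set k := Nat.find hj with hk
  obtain ⟨hkn, hne⟩ := Nat.find_spec hj
  have hagree (m : ℕ) (hm : m < k) : j m = i m := by
    by_contra hc
    exact Nat.find_min hj hm ⟨hm.trans hkn, hc⟩
  have haff (i : ℕ → Fin N) : canonicalProj A v (shift k i) =
      affMap A v (i k) (canonicalProj A v (shift 1 (shift k i))) := by
    rw [canonicalProj_eq v hcontr (shift k i) 1]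
    simp [partialProj, pre, wordProd_nil, linMap_one, wordProd_singleton, affMap, shift, add_comm]
  have h1 : d ≤ ‖canonicalProj A v (shift k j) - canonicalProj A v (shift k i)‖ := by
    rw [haff i, haff j, ← dist_eq_norm]
    exact h _ _ hne _ (hX.canonicalProj_mem hcontr _) _ (hX.canonicalProj_mem hcontr _)
  have h2 : alpha2 A (pre i n) ≤ alpha2 A (pre i k) := by
    rw [← Nat.add_sub_cancel' hkn.le, pre_add]
    exact (alpha2_append_le A _ _).trans (mul_le_of_le_one_right (alpha2_pos A _).le
      ((hla _).trans (pow_le_one₀ hl.le hl1.le)))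
  rw [dist_eq_norm, canonicalProj_sub v hcontr hagree]
  calc d * alpha2 A (pre i n) ≤
      ‖canonicalProj A v (shift k j) - canonicalProj A v (shift k i)‖ * alpha2 A (pre i k) :=
        mul_le_mul h1 h2 (alpha2_pos A _).le (norm_nonneg _)
    _ ≤ _ := by
        rw [mul_comm]
        exact alpha2_mul_norm_le A _ _

end Coding

/-! ### Quasi-Bernoulli measures of closed sets -/

section QuasiBernoulli

variable {N : ℕ} {μ : Measure (ℕ → Fin N)} [IsProbabilityMeasure μ]

/-- The unions of m-cylinders meeting G decrease to G because G is closed. -/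
theorem tendsto_measureReal_cylinder_hull {G : Set (ℕ → Fin N)} (hG : IsClosed G) :
    Tendsto (fun m : ℕ => μ.real ((fun (i : ℕ → Fin N) (k : Fin m) => i k) ⁻¹'
      ((fun (i : ℕ → Fin N) (k : Fin m) => i k) '' G))) atTop (𝓝 (μ.real G)) := by
  set H : ℕ → Set (ℕ → Fin N) := fun m => (fun (i : ℕ → Fin N) (k : Fin m) => i k) ⁻¹'
      ((fun (i : ℕ → Fin N) (k : Fin m) => i k) '' G) with hH
  have hmem (m : ℕ) (j : ℕ → Fin N) : j ∈ H m ↔ ∃ g ∈ G, ∀ k < m, g k = j k := by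
    simp only [hH, Set.mem_preimage, Set.mem_image, funext_iff]
    exact ⟨fun ⟨g, hg, h⟩ => ⟨g, hg, fun k hk => h ⟨k, hk⟩⟩, fun ⟨g, hg, h⟩ => ⟨g, hg, fun k => h k k.2⟩⟩
  have hanti : Antitone H := by
    intro m m' hm j hj
    rw [hmem] at hj ⊢
    obtain ⟨g, hg, h⟩ := hj
    exact ⟨g, hg, fun k hk => h k (hk.trans_le hm)⟩
  have hinter : ⋂ m, H m = G := by
    ext j
    rw [Set.mem_iInter]
    constructor
    · intro h
      have h2 := fun m => (hmem m j).1 (h m)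
      choose g hg hgj using h2
      refine hG.mem_of_tendsto (f := g) (b := atTop) ?_ (Eventually.of_forall hg)
      refine tendsto_pi_nhds.2 fun k => ?_
      refine tendsto_const_nhds.congr' ?_
      filter_upwards [eventually_gt_atTop k] with m hm
      exact (hgj m k hm).symm
    · exact fun hj m => (hmem m j).2 ⟨j, hj, fun _ _ => rfl⟩
  have hmeas (m : ℕ) : MeasurableSet (H m) :=
    (continuous_truncate m).measurable (Set.toFinite _).measurableSet
  have := tendsto_measure_iInter_atTop (μ := μ) (fun m => (hmeas m).nullMeasurableSet) hanti
    ⟨0, measure_ne_top _ _⟩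
  rw [hinter] at this
  exact (ENNReal.tendsto_toReal (measure_ne_top _ _)).comp this

/-- The upper quasi-Bernoulli bound passes from cylinders to closed sets: cover G by m-cylinders,
sum, and let m → ∞. The ellipses pulled back from balls are sets of this kind. -/
theorem IsQuasiBernoulli.exists_measureReal_le (hqB : IsQuasiBernoulli μ) :
    ∃ C : ℝ, 1 ≤ C ∧ ∀ (i : ℕ → Fin N) (n : ℕ) (G : Set (ℕ → Fin N)), IsClosed G →
      μ.real (wordCylinder (pre i n) ∩ shift n ⁻¹' G) ≤
        C * (μ.real (wordCylinder (pre i n)) * μ.real G) := by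
  obtain ⟨C, hC, h⟩ := hqB
  refine ⟨C, hC, fun i n G hG => ?_⟩
  refine ge_of_tendsto (((tendsto_measureReal_cylinder_hull hG).const_mul _).const_mul C)
    (Eventually.of_forall fun m => ?_)
  classical
  set ρ : (ℕ → Fin N) → Fin m → Fin N := fun i k => i k with hρ
  have hρm : Measurable ρ := (continuous_truncate m).measurable
  set T : Finset (Fin m → Fin N) := (Set.toFinite (ρ '' G)).toFinset with hT
  have hTG : (T : Set (Fin m → Fin N)) = ρ '' G := by simp [hT]
  have h1 : μ.real (ρ ⁻¹' (ρ '' G)) = ∑ u ∈ T, μ.real (wordCylinder (List.ofFn u)) := by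
    simp only [wordCylinder_ofFn]
    rw [sum_measureReal_preimage_singleton _ fun y _ => hρm (MeasurableSet.singleton _), hTG]
  have h2 : wordCylinder (pre i n) ∩ shift n ⁻¹' G ⊆
      ⋃ u ∈ T, wordCylinder (pre i n ++ List.ofFn u) := by
    rintro j ⟨hj, hjG⟩
    refine Set.mem_iUnion₂.2 ⟨ρ (shift n j), ?_, ?_⟩
    · rw [← Finset.mem_coe, hTG]
      exact ⟨_, hjG, rfl⟩
    · have h3 : pre i n = pre j n := (pre_eq_of_agree (mem_wordCylinder_pre.1 hj)).symm
      rw [h3]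
      change j ∈ wordCylinder (pre j n ++ pre (shift n j) m)
      rw [← pre_add]
      exact self_mem_wordCylinder_pre _ _
  calc μ.real (wordCylinder (pre i n) ∩ shift n ⁻¹' G)
      ≤ μ.real (⋃ u ∈ T, wordCylinder (pre i n ++ List.ofFn u)) :=
        measureReal_mono h2 (measure_ne_top _ _)
    _ ≤ ∑ u ∈ T, μ.real (wordCylinder (pre i n ++ List.ofFn u)) :=
        measureReal_biUnion_finset_le _ _
    _ ≤ ∑ u ∈ T, C * (μ.real (wordCylinder (pre i n)) * μ.real (wordCylinder (List.ofFn u))) :=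
        Finset.sum_le_sum fun u _ => (h _ _).2
    _ = _ := by rw [h1, Finset.mul_sum, Finset.mul_sum]

end QuasiBernoulli

/-! ### Multifractal upper bounds -/

/-- At every small scale `r` the set `X` splits into cells of diameter comparable to `r`, grouped
into countably many classes, such that the sum of `m(B(x, r))^q` over the cells is `O(r^T)`. -/
def HasLqBound {ι : Type*} (X : Set Plane) (m : Measure Plane) (q T : ℝ) (ψ : ι → ℝ) : Prop :=
  ∃ C r₀ : ℝ, 0 < C ∧ 0 < r₀ ∧ ∀ r : ℝ, 0 < r → r < r₀ →
    ∃ (W : Plane → ι) (M : ι → ℕ) (cell : Plane → ℕ), ∀ x ∈ X, cell x < M (W x) ∧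
      M (W x) * m.real (Metric.closedBall x r) ^ q ≤ C * r ^ T * ψ (W x) ∧
      ∀ y ∈ X, W y = W x → cell y = cell x → dist x y ≤ C * r

section Multifractal

variable {ι : Type*} {X E : Set Plane} {m : Measure Plane} {q T p : ℝ} {ψ : ι → ℝ}

theorem HasLqBound.eq_empty (h : HasLqBound X m q T ψ) (hψ0 : ∀ w, 0 ≤ ψ w) (hψ : Summable ψ)
    (hq : 0 < q) (hE : E ⊆ X) {δ : ℝ} (hδ : 0 < δ)
    (hm : ∀ x ∈ E, ∀ r : ℝ, 0 < r → r < δ → r ^ p ≤ m.real (Metric.closedBall x r))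
    (hpT : p * q < T) : E = ∅ := by
  obtain ⟨C, r₀, hC, hr₀, h⟩ := h
  by_contra hne
  obtain ⟨x, hx⟩ := Set.nonempty_iff_ne_empty.2 hne
  have h1 : ∀ᶠ r : ℝ in 𝓝[>] 0, 1 ≤ C * (∑' w, ψ w) * r ^ (T - p * q) := by
    filter_upwards [Ioo_mem_nhdsGT (lt_min hr₀ hδ)] with r hr
    obtain ⟨W, M, cell, hW⟩ := h r hr.1 (hr.2.trans_le (min_le_left _ _))
    obtain ⟨h2, h3, -⟩ := hW x (hE hx)
    have h4 := hm x hx r hr.1 (hr.2.trans_le (min_le_right _ _))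
    have h5 : r ^ (p * q) ≤ m.real (Metric.closedBall x r) ^ q := by
      rw [Real.rpow_mul hr.1.le]
      exact Real.rpow_le_rpow (Real.rpow_nonneg hr.1.le _) h4 hq.le
    have h6 : (1 : ℝ) ≤ M (W x) := by exact_mod_cast (Nat.zero_le _).trans_lt h2
    have h7 := Real.rpow_pos_of_pos hr.1 (p * q)
    have h8 : ψ (W x) ≤ ∑' w, ψ w := hψ.le_tsum _ fun _ _ => hψ0 _
    have h9 : r ^ (p * q) ≤ C * r ^ T * ∑' w, ψ w := by
      calc r ^ (p * q) ≤ M (W x) * m.real (Metric.closedBall x r) ^ q := by nlinarith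
        _ ≤ C * r ^ T * ψ (W x) := h3
        _ ≤ _ := mul_le_mul_of_nonneg_left h8
          (mul_nonneg hC.le (Real.rpow_nonneg hr.1.le _))
    rw [Real.rpow_sub hr.1, mul_div_assoc', le_div_iff₀ h7]
    linarith
  have h2 : Tendsto (fun r : ℝ => C * (∑' w, ψ w) * r ^ (T - p * q)) (𝓝[>] 0)
      (𝓝 (C * (∑' w, ψ w) * 0)) := by
    refine Tendsto.const_mul _ ?_
    have := (Real.continuousAt_rpow_const 0 (T - p * q) (Or.inr (by linarith))).tendsto
    rw [Real.zero_rpow (by linarith)] at this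
    exact this.mono_left nhdsWithin_le_nhds
  have h3 := ge_of_tendsto h2 h1
  rw [mul_zero] at h3
  linarith

theorem HasLqBound.dimH_le [Countable ι] [Nonempty ι] (h : HasLqBound X m q T ψ) (hψ0 : ∀ w, 0 ≤ ψ w)
    (hψ : Summable ψ) (hq : 0 < q) (hE : E ⊆ X) {δ : ℝ} (hδ : 0 < δ)
    (hm : ∀ x ∈ E, ∀ r : ℝ, 0 < r → r < δ → r ^ p ≤ m.real (Metric.closedBall x r))
    (hpT : T < p * q) : dimH E ≤ ENNReal.ofReal (p * q - T) := by
  obtain ⟨C, r₀, hC, hr₀, h⟩ := h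
  have hd : 0 < p * q - T := sub_pos.2 hpT
  set d := p * q - T with hd'
  choose! W M cell h using h
  set t : ℝ → ι × ℕ → Set Plane := fun r k => {x ∈ E | W r x = k.1 ∧ cell r x = k.2} with ht
  have hsmall : ∀ᶠ r : ℝ in 𝓝[>] 0, r ∈ Set.Ioo 0 (min r₀ δ) := Ioo_mem_nhdsGT (lt_min hr₀ hδ)
  have hdiam (r : ℝ) (hr : r ∈ Set.Ioo 0 (min r₀ δ)) (k : ι × ℕ) :
      Metric.ediam (t r k) ≤ ENNReal.ofReal (C * r) := by
    refine Metric.ediam_le fun x hx y hy => ?_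
    rw [edist_dist]
    refine ENNReal.ofReal_le_ofReal ?_
    exact (h r hr.1 (hr.2.trans_le (min_le_left _ _)) x (hE hx.1)).2.2 y (hE hy.1)
      (hy.2.1.trans hx.2.1.symm) (hy.2.2.trans hx.2.2.symm)
  -- One point of E in class w bounds the number of cells: M(w) r^(pq) ≤ C r^T ψ(w). Classes missing
  -- E contribute nothing, since d > 0.
  have hclass (r : ℝ) (hr : r ∈ Set.Ioo 0 (min r₀ δ)) (w : ι) :
      ∑' k : ℕ, Metric.ediam (t r (w, k)) ^ d ≤ ENNReal.ofReal (C ^ d * C * ψ w) := by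
    by_cases hw : ∃ x ∈ E, W r x = w
    swap
    · have h0 (k : ℕ) : Metric.ediam (t r (w, k)) ^ d = 0 := by
        have : t r (w, k) = ∅ := by
          ext x
          simp only [ht, Set.mem_ofPred_eq, Set.mem_empty_iff_false, iff_false]
          exact fun hx => hw ⟨x, hx.1, hx.2.1⟩
        rw [this, Metric.ediam_empty, ENNReal.zero_rpow_of_pos hd]
      simp [h0]
    obtain ⟨x, hx, rfl⟩ := hw
    have hr0 := hr.1
    have hrr := hr.2.trans_le (min_le_left _ _)
    obtain ⟨h2, h3, -⟩ := h r hr0 hrr x (hE hx)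
    have h4 := hm x hx r hr0 (hr.2.trans_le (min_le_right _ _))
    have h5 : r ^ (p * q) ≤ m.real (Metric.closedBall x r) ^ q := by
      rw [Real.rpow_mul hr0.le]
      exact Real.rpow_le_rpow (Real.rpow_nonneg hr0.le _) h4 hq.le
    have h6 : (M r (W r x) : ℝ) * (C * r) ^ d ≤ C ^ d * C * ψ (W r x) := by
      have h7 := Real.rpow_pos_of_pos hr0 T
      have h8 : (M r (W r x) : ℝ) * r ^ (p * q) ≤ C * r ^ T * ψ (W r x) :=
        (mul_le_mul_of_nonneg_left h5 (Nat.cast_nonneg _)).trans h3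
      rw [Real.mul_rpow hC.le hr0.le, hd', Real.rpow_sub hr0]
      have h9 : (M r (W r x) : ℝ) * (r ^ (p * q) / r ^ T) ≤ C * ψ (W r x) := by
        rw [mul_div_assoc', div_le_iff₀ h7]
        linarith
      have := mul_le_mul_of_nonneg_left h9 (Real.rpow_nonneg hC.le (p * q - T))
      linarith
    have hvanish (k : ℕ) (hk : k ∉ Finset.range (M r (W r x))) :
        Metric.ediam (t r (W r x, k)) ^ d = 0 := by
      have : t r (W r x, k) = ∅ := by
        ext y
        simp only [ht, Set.mem_ofPred_eq, Set.mem_empty_iff_false, iff_false]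
        rintro ⟨hy, hyW, rfl⟩
        have := (h r hr0 hrr y (hE hy)).1
        rw [hyW] at this
        exact hk (Finset.mem_range.2 this)
      rw [this, Metric.ediam_empty, ENNReal.zero_rpow_of_pos hd]
    rw [tsum_eq_sum hvanish]
    calc ∑ k ∈ Finset.range (M r (W r x)), Metric.ediam (t r (W r x, k)) ^ d
        ≤ ∑ k ∈ Finset.range (M r (W r x)), ENNReal.ofReal (C * r) ^ d :=
          Finset.sum_le_sum fun k _ => ENNReal.rpow_le_rpow (hdiam r hr _) hd.le
      _ = ENNReal.ofReal (M r (W r x) * (C * r) ^ d) := by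
          rw [Finset.sum_const, Finset.card_range, nsmul_eq_mul,
            ENNReal.ofReal_mul (Nat.cast_nonneg _), ENNReal.ofReal_natCast,
            ENNReal.ofReal_rpow_of_pos (mul_pos hC hr0)]
      _ ≤ _ := ENNReal.ofReal_le_ofReal h6
  have hbound : μH[d] E ≤ ENNReal.ofReal (C ^ d * C * ∑' w, ψ w) := by
    refine (Measure.hausdorffMeasure_le_liminf_tsum (l := 𝓝[>] (0 : ℝ)) d E
      (fun r => ENNReal.ofReal (C * r)) ?_ t (hsmall.mono fun r hr => hdiam r hr) ?_).trans ?_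
    · have : Tendsto (fun r : ℝ => ENNReal.ofReal (C * r)) (𝓝 0) (𝓝 (ENNReal.ofReal (C * 0))) :=
        ENNReal.tendsto_ofReal (tendsto_id.const_mul C)
      rw [mul_zero, ENNReal.ofReal_zero] at this
      exact this.mono_left nhdsWithin_le_nhds
    · exact Eventually.of_forall fun r x hx =>
        Set.mem_iUnion.2 ⟨(W r x, cell r x), hx, rfl, rfl⟩
    · refine liminf_le_of_frequently_le' (hsmall.mono fun r hr => ?_).frequently
      rw [ENNReal.tsum_prod (f := fun w k => Metric.ediam (t r (w, k)) ^ d)]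
      refine (ENNReal.tsum_le_tsum fun w => hclass r hr w).trans ?_
      rw [← ENNReal.ofReal_tsum_of_nonneg
        (fun w => mul_nonneg (mul_nonneg (Real.rpow_nonneg hC.le _) hC.le) (hψ0 w))
        (hψ.mul_left _), tsum_mul_left]
  rw [ENNReal.ofReal]
  refine dimH_le_of_hausdorffMeasure_ne_top ?_
  rw [Real.coe_toNNReal _ hd.le]
  exact (hbound.trans_lt ENNReal.ofReal_lt_top).ne

theorem exists_rpow_le_of_hasLocalDim {x : Plane} {s : ℝ} (hx : HasLocalDim m x s)
    (hpos : ∀ r : ℝ, 0 < r → 0 < m.real (Metric.closedBall x r)) (hsp : s < p) :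
    ∃ n : ℕ, ∀ r : ℝ, 0 < r → r < 1 / ((n : ℝ) + 1) → r ^ p ≤ m.real (Metric.closedBall x r) := by
  have h1 := hx.eventually_lt_const hsp
  obtain ⟨u, hu, h⟩ := mem_nhdsGT_iff_exists_Ioo_subset.1 h1
  obtain ⟨n, hn⟩ := exists_nat_one_div_lt (lt_min hu one_pos : (0 : ℝ) < min u 1)
  refine ⟨n, fun r hr hrn => ?_⟩
  have hr2 := lt_min_iff.1 (hrn.trans hn)
  have h2 : Real.log (m.real (Metric.closedBall x r)) / Real.log r < p := h ⟨hr, hr2.1⟩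
  rw [div_lt_iff_of_neg (Real.log_neg hr hr2.2)] at h2
  rw [← Real.log_le_log_iff (Real.rpow_pos_of_pos hr _) (hpos r hr), Real.log_rpow hr]
  exact h2.le

/-- The upper bound of the multifractal formalism. -/
theorem hausdorffDim_levelSet_le [Countable ι] [Nonempty ι] {τ s : ℝ} (hq : 0 < q)
    (hpos : ∀ x ∈ X, ∀ r : ℝ, 0 < r → 0 < m.real (Metric.closedBall x r))
    (h : ∀ T < τ, ∃ ψ : ι → ℝ, (∀ w, 0 ≤ ψ w) ∧ Summable ψ ∧ HasLqBound X m q T ψ) :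
    hausdorffDim (levelSet X m s) ≤ ((q * s - τ : ℝ) : EReal) := by
  set E : ℝ → ℕ → Set Plane := fun p n => {x ∈ X | ∀ r : ℝ, 0 < r → r < 1 / ((n : ℝ) + 1) →
    r ^ p ≤ m.real (Metric.closedBall x r)} with hE
  have hcover (p : ℝ) (hp : s < p) : levelSet X m s ⊆ ⋃ n, E p n := by
    rintro x ⟨hxX, hx⟩
    obtain ⟨n, hn⟩ := exists_rpow_le_of_hasLocalDim hx (hpos x hxX) hp
    exact Set.mem_iUnion.2 ⟨n, hxX, hn⟩
  rcases lt_or_ge (q * s - τ) 0 with hneg | hnonneg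
  · obtain ⟨p, hp1, hp2⟩ : ∃ p, s < p ∧ p < τ / q :=
      exists_between ((lt_div_iff₀ hq).2 (by linarith))
    rw [lt_div_iff₀ hq] at hp2
    -- The midpoint lies strictly between pq and τ.
    obtain ⟨ψ, hψ0, hψ, hL⟩ := h ((p * q + τ) / 2) (by linarith)
    have hempty : levelSet X m s = ∅ := by
      refine Set.subset_empty_iff.1 ((hcover p hp1).trans (Set.iUnion_subset fun n => ?_))
      exact (hL.eq_empty hψ0 hψ hq (fun x hx => hx.1) (Nat.one_div_pos_of_nat (n := n))
        (fun x hx => hx.2) (by linarith)).subset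
    rw [hausdorffDim, if_pos hempty]
    exact bot_le
  · have hdim : dimH (levelSet X m s) ≤ ENNReal.ofReal (q * s - τ) := by
      refine ENNReal.le_of_forall_pos_le_add fun ε hε _ => ?_
      have hε' : (0 : ℝ) < ε := hε
      -- Half of ε is spent on T < τ and half on p = s + ε/(2q) > s.
      obtain ⟨ψ, hψ0, hψ, hL⟩ := h (τ - ε / 2) (by linarith)
      have hp : s < s + ε / (2 * q) := by
        have : 0 < (ε : ℝ) / (2 * q) := by positivity
        linarith
      have hpq : (s + ε / (2 * q)) * q = q * s + ε / 2 := by field_simp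
      calc dimH (levelSet X m s) ≤ dimH (⋃ n, E (s + ε / (2 * q)) n) := dimH_mono (hcover _ hp)
        _ = ⨆ n, dimH (E (s + ε / (2 * q)) n) := dimH_iUnion _
        _ ≤ ENNReal.ofReal ((s + ε / (2 * q)) * q - (τ - ε / 2)) := iSup_le fun n =>
            hL.dimH_le hψ0 hψ hq (fun x hx => hx.1) (Nat.one_div_pos_of_nat (n := n))
              (fun x hx => hx.2) (by rw [hpq]; linarith)
        _ ≤ ENNReal.ofReal (q * s - τ + ε) := ENNReal.ofReal_le_ofReal (by rw [hpq]; linarith)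
        _ = ENNReal.ofReal (q * s - τ) + ε := by
            rw [ENNReal.ofReal_add hnonneg hε'.le, ENNReal.ofReal_coe_nnreal]
    rw [hausdorffDim]
    split_ifs
    · exact bot_le
    · refine (EReal.coe_ennreal_le_coe_ennreal_iff.2 hdim).trans ?_
      rw [EReal.coe_ennreal_ofReal, max_eq_left hnonneg]

end Multifractal

/-! ### Measures of balls -/

/-- Take the predecessor of the first index with ρ f < r. It exists because f 0 = 1 and r ≤ ρ, and a
single step loses at most the factor L. -/
theorem exists_stopping {f : ℕ → ℝ} {L ρ r : ℝ} (hf0 : f 0 = 1) (hf : Tendsto f atTop (𝓝 0))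
    (hL : ∀ n, f n ≤ L * f (n + 1)) (hL0 : 0 ≤ L) (hρ : 0 < ρ) (hr : 0 < r) (hrρ : r ≤ ρ) :
    ∃ n, r ≤ ρ * f n ∧ ρ * f n ≤ L * r := by
  classical
  have hex : ∃ n, ρ * f n < r := by
    have h1 := hf.const_mul ρ
    rw [mul_zero] at h1
    exact (h1.eventually_lt_const hr).exists
  obtain ⟨n, hn⟩ : ∃ n, Nat.find hex = n + 1 := by
    refine Nat.exists_eq_succ_of_ne_zero fun h0 => ?_
    have := Nat.find_spec hex
    rw [h0, hf0, mul_one] at this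
    linarith
  have h1 := Nat.find_spec hex
  have h2 := Nat.find_min hex (m := n) (by omega)
  rw [hn] at h1
  refine ⟨n, not_lt.1 h2, ?_⟩
  calc ρ * f n ≤ ρ * (L * f (n + 1)) := mul_le_mul_of_nonneg_left (hL n) hρ.le
    _ = L * (ρ * f (n + 1)) := by ring
    _ ≤ L * r := mul_le_mul_of_nonneg_left h1.le hL0

theorem exists_le_rpow {a : ℝ} (ha : 0 < a) (b e : ℝ) :
    ∃ c : ℝ, 0 < c ∧ ∀ y : ℝ, a ≤ y → y ≤ b → c ≤ y ^ e := by
  rcases lt_or_ge b a with hab | hab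
  · exact ⟨1, one_pos, fun y h1 h2 => by linarith⟩
  have hb := ha.trans_le hab
  refine ⟨min (a ^ e) (b ^ e), lt_min (Real.rpow_pos_of_pos ha _) (Real.rpow_pos_of_pos hb _),
    fun y h1 h2 => ?_⟩
  rcases le_or_gt 0 e with he | he
  · exact (min_le_left _ _).trans (Real.rpow_le_rpow ha.le h1 he)
  · exact (min_le_right _ _).trans (Real.rpow_le_rpow_of_nonpos (ha.trans_le h1) h2 he.le)

/-- Only the ratio r/a enters, so the product is comparable to 1 once a is comparable to r. -/
theorem rpow_mul_rpow_rpow {r a : ℝ} (hr : 0 < r) (ha : 0 < a) (q t : ℝ) :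
    r ^ ((q - 1) * t) * (a ^ t) ^ (1 - q) = (r / a) ^ ((q - 1) * t) := by
  rw [← Real.rpow_mul ha.le, Real.div_rpow hr.le ha.le, div_eq_mul_inv, ← Real.rpow_neg ha.le]
  congr 2
  ring

/-- In the orthonormal basis x, `rot x` the component along x is killed and the other coefficient is
the area x ∧ z. -/
theorem norm_projPerp_le {V : ℙ ℝ Plane} {x : Plane} (hx : x ∈ V.submodule) (hx1 : ‖x‖ = 1)
    (z : Plane) : ‖projPerp V z‖ ≤ |wedge x z| := by
  have h1 := wedge_smul_eq z x (rot x)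
  rw [wedge_rot, hx1, one_pow, one_smul] at h1
  have h2 : projPerp V x = 0 := by
    rw [projPerp]
    exact Submodule.starProjection_orthogonal_apply_eq_zero hx
  rw [h1, map_add, map_smul, map_smul, h2, smul_zero, zero_add, norm_smul, Real.norm_eq_abs, ← h1]
  refine mul_le_of_le_one_right (abs_nonneg _) ?_
  have h3 : ‖projPerp V (rot x)‖ ≤ ‖rot x‖ := Submodule.norm_starProjection_apply_le _ _
  rwa [norm_rot, hx1] at h3

section Balls

variable {N : ℕ} {A : Fin N → GL (Fin 2) ℝ} {v : Fin N → Plane} {X : Set Plane}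
  {μ : Measure (ℕ → Fin N)} [IsProbabilityMeasure μ] {q : ℝ}

theorem tendsto_alpha1_pre (hcontr : ∀ i, ‖linMap (A i)‖ < 1) (i : ℕ → Fin N) :
    Tendsto (fun n => alpha1 A (pre i n)) atTop (𝓝 0) := by
  obtain ⟨l, hl, hl1, hla⟩ := exists_alpha1_le_pow A hcontr
  exact squeeze_zero (fun _ => (alpha1_pos A _).le) (fun n => by simpa using hla (pre i n))
    (tendsto_pow_atTop_nhds_zero_of_lt_one hl.le hl1)

theorem tendsto_alpha2_pre (hcontr : ∀ i, ‖linMap (A i)‖ < 1) (i : ℕ → Fin N) :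
    Tendsto (fun n => alpha2 A (pre i n)) atTop (𝓝 0) :=
  squeeze_zero (fun _ => (alpha2_pos A _).le) (fun _ => alpha2_le_alpha1 A _)
    (tendsto_alpha1_pre hcontr i)

theorem exists_alpha_pre_le_succ (A : Fin N → GL (Fin 2) ℝ) :
    ∃ L : ℝ, 0 < L ∧ ∀ (i : ℕ → Fin N) (n : ℕ),
      alpha1 A (pre i n) ≤ L * alpha1 A (pre i (n + 1)) ∧
      alpha2 A (pre i n) ≤ L * alpha2 A (pre i (n + 1)) := by
  obtain ⟨k, hk, hk1, hka⟩ := exists_pow_le_alpha2 A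
  refine ⟨k⁻¹, inv_pos.2 hk, fun i n => ?_⟩
  have h1 : k ≤ alpha2 A [i n] := by simpa using hka [i n]
  rw [le_inv_mul_iff₀ hk, le_inv_mul_iff₀ hk, pre_succ]
  constructor
  · refine le_trans ?_ (alpha1_mul_alpha2_le_append A _ _)
    rw [mul_comm]
    exact mul_le_mul_of_nonneg_left h1 (alpha1_pos A _).le
  · refine le_trans ?_ (le_alpha2_append A _ _)
    rw [mul_comm]
    exact mul_le_mul_of_nonneg_left h1 (alpha2_pos A _).le

theorem measureReal_map_canonicalProj (hcontr : ∀ i, ‖linMap (A i)‖ < 1) {S : Set Plane}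
    (hS : MeasurableSet S) {ν : Measure (ℕ → Fin N)} :
    (ν.map (canonicalProj A v)).real S = ν.real (canonicalProj A v ⁻¹' S) :=
  map_measureReal_apply (continuous_canonicalProj v hcontr).measurable hS

/-- The ball contains the image of a long cylinder around a code of x. Positivity is what allows
logarithms to be compared. -/
theorem measureReal_closedBall_pos (hcontr : ∀ i, ‖linMap (A i)‖ < 1)
    (hX : IsSelfAffineSet A v X) (hfull : IsFullySupported μ) {x : Plane} (hx : x ∈ X) {r : ℝ}
    (hr : 0 < r) : 0 < (μ.map (canonicalProj A v)).real (Metric.closedBall x r) := by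
  obtain ⟨i, rfl⟩ := hX.exists_canonicalProj_eq hcontr hx
  obtain ⟨R, hR⟩ := hX.2.1.isBounded.exists_norm_le
  have h1 := (tendsto_alpha1_pre hcontr i).mul_const (R + R)
  rw [zero_mul] at h1
  obtain ⟨n, hn⟩ := (h1.eventually_lt_const hr).exists
  rw [measureReal_map_canonicalProj hcontr Metric.isClosed_closedBall.measurableSet]
  refine (measureReal_wordCylinder_pos hfull (pre i n)).trans_le
    (measureReal_mono (fun j hj => ?_) (measure_ne_top _ _))
  rw [Set.mem_preimage, Metric.mem_closedBall, dist_eq_norm,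
    canonicalProj_sub v hcontr (mem_wordCylinder_pre.1 hj)]
  refine (norm_linMap_le A _ _).trans (le_trans ?_ hn.le)
  refine mul_le_mul_of_nonneg_left ?_ (alpha1_pos A _).le
  exact (norm_sub_le _ _).trans (add_le_add (hR _ (hX.canonicalProj_mem hcontr _))
    (hR _ (hX.canonicalProj_mem hcontr _)))

theorem IsSelfAffineSet.exists_code (hX : IsSelfAffineSet A v X)
    (hcontr : ∀ i, ‖linMap (A i)‖ < 1) :
    ∃ code : Plane → ℕ → Fin N, ∀ x ∈ X, canonicalProj A v (code x) = x := by
  obtain ⟨y, hy⟩ := hX.1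
  obtain ⟨j, -⟩ := hX.exists_canonicalProj_eq hcontr hy
  have : Nonempty (ℕ → Fin N) := ⟨j⟩
  choose! code hcode using fun x (hx : x ∈ X) => hX.exists_canonicalProj_eq hcontr hx
  exact ⟨code, hcode⟩

/-- Each class is a single cell: the cylinder of a code stopped when ρ α₁ is comparable to r. Its
diameter is O(r), and the hypothesis bounds the mass of the ball by that of the cylinder. -/
theorem hasLqBound_of_ball_le_cylinder (hcontr : ∀ i, ‖linMap (A i)‖ < 1)
    (hX : IsSelfAffineSet A v X) (hq : 1 < q) {ρ C : ℝ} (hρ : 0 < ρ) (hC : 1 ≤ C)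
    (h : ∀ (i : ℕ → Fin N) (n : ℕ), (μ.map (canonicalProj A v)).real
      (Metric.closedBall (canonicalProj A v i) (ρ * alpha1 A (pre i n))) ≤
        C * μ.real (wordCylinder (pre i n))) (t : ℝ) :
    HasLqBound X (μ.map (canonicalProj A v)) q ((q - 1) * t)
      fun w : List (Fin N) => μ.real (wordCylinder w) ^ q * (alpha1 A w ^ t) ^ (1 - q) := by
  obtain ⟨R, hR⟩ := hX.2.1.isBounded.exists_norm_le
  obtain ⟨L, hL, hLA⟩ := exists_alpha_pre_le_succ A
  have hC0 : 0 < C := one_pos.trans_le hC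
  obtain ⟨code, hcode⟩ := hX.exists_code hcontr
  obtain ⟨c, hc, hcr⟩ := exists_le_rpow (div_pos hρ hL) ρ ((q - 1) * t)
  refine ⟨max (C ^ q / c) (L / ρ * (R + R)), ρ,
    lt_max_of_lt_left (div_pos (Real.rpow_pos_of_pos hC0 _) hc), hρ, fun r hr hrρ => ?_⟩
  have hn (x : Plane) : ∃ n, r ≤ ρ * alpha1 A (pre (code x) n) ∧
      ρ * alpha1 A (pre (code x) n) ≤ L * r :=
    exists_stopping (by simp [pre, alpha1_nil]) (tendsto_alpha1_pre hcontr _)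
      (fun n => (hLA _ n).1) hL.le hρ hr hrρ.le
  choose n hn1 hn2 using hn
  refine ⟨fun x => pre (code x) (n x), fun _ => 1, fun _ => 0, fun x hx => ⟨one_pos, ?_, ?_⟩⟩
  · set w := pre (code x) (n x) with hw
    have ha := alpha1_pos A w
    have h1 : (μ.map (canonicalProj A v)).real (Metric.closedBall x r) ≤
        C * μ.real (wordCylinder w) := by
      refine (measureReal_mono ?_ (measure_ne_top _ _)).trans (h (code x) (n x))
      rw [hcode x hx]
      exact Metric.closedBall_subset_closedBall (hn1 x)
    have h2 := hcr (r / alpha1 A w)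
      (by
        have := hn2 x
        rw [← hw] at this
        rw [div_le_div_iff₀ hL ha]
        linarith)
      (by rw [div_le_iff₀ ha]; exact hn1 x)
    rw [← rpow_mul_rpow_rpow hr ha] at h2
    have hμ : (0 : ℝ) ≤ μ.real (wordCylinder w) ^ q := Real.rpow_nonneg measureReal_nonneg _
    have hψ : (0 : ℝ) ≤ r ^ ((q - 1) * t) *
        (μ.real (wordCylinder w) ^ q * (alpha1 A w ^ t) ^ (1 - q)) :=
      mul_nonneg (Real.rpow_nonneg hr.le _)
        (mul_nonneg hμ (Real.rpow_nonneg (Real.rpow_nonneg ha.le _) _))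
    rw [Nat.cast_one, one_mul]
    calc (μ.map (canonicalProj A v)).real (Metric.closedBall x r) ^ q
        ≤ (C * μ.real (wordCylinder w)) ^ q :=
          Real.rpow_le_rpow measureReal_nonneg h1 (by linarith)
      _ = C ^ q / c * μ.real (wordCylinder w) ^ q * c := by
          rw [Real.mul_rpow hC0.le measureReal_nonneg]
          field_simp
      _ ≤ C ^ q / c * μ.real (wordCylinder w) ^ q *
            (r ^ ((q - 1) * t) * (alpha1 A w ^ t) ^ (1 - q)) :=
          mul_le_mul_of_nonneg_left h2
            (mul_nonneg (div_nonneg (Real.rpow_nonneg hC0.le _) hc.le) hμ)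
      _ = C ^ q / c * (r ^ ((q - 1) * t) *
            (μ.real (wordCylinder w) ^ q * (alpha1 A w ^ t) ^ (1 - q))) := by ring
      _ ≤ max (C ^ q / c) (L / ρ * (R + R)) * (r ^ ((q - 1) * t) *
            (μ.real (wordCylinder w) ^ q * (alpha1 A w ^ t) ^ (1 - q))) :=
          mul_le_mul_of_nonneg_right (le_max_left _ _) hψ
      _ = _ := by ring
  · intro y hy hyx _
    have hagree : code y ∈ wordCylinder (pre (code x) (n x)) := by
      have : pre (code y) (n y) = pre (code x) (n x) := hyx
      rw [← this]
      exact self_mem_wordCylinder_pre _ _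
    rw [dist_comm, dist_eq_norm]
    conv_lhs => rw [← hcode x hx, ← hcode y hy]
    rw [canonicalProj_sub v hcontr (mem_wordCylinder_pre.1 hagree)]
    have hRR : (0 : ℝ) ≤ R + R := by linarith [(norm_nonneg x).trans (hR x hx)]
    calc _ ≤ alpha1 A (pre (code x) (n x)) * (R + R) :=
          (norm_linMap_le A _ _).trans (mul_le_mul_of_nonneg_left
            ((norm_sub_le _ _).trans (add_le_add (hR _ (hX.canonicalProj_mem hcontr _))
              (hR _ (hX.canonicalProj_mem hcontr _)))) (alpha1_pos A _).le)
      _ ≤ L / ρ * r * (R + R) := by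
          refine mul_le_mul_of_nonneg_right ?_ hRR
          rw [div_mul_eq_mul_div, le_div_iff₀ hρ, mul_comm]
          exact hn2 x
      _ = L / ρ * (R + R) * r := by ring
      _ ≤ _ := mul_le_mul_of_nonneg_right (le_max_right _ _) hr.le

end Balls

/-! ### Ball measures and cells under the projection condition -/

section Projections

variable {N : ℕ} {A : Fin N → GL (Fin 2) ℝ} {v : Fin N → Plane} {X : Set Plane}
  {μ : Measure (ℕ → Fin N)} [IsProbabilityMeasure μ] {q : ℝ}

/-- A word contracting the direction `x` maximally stretches the transversal direction. -/
theorem alpha1_mul_abs_wedge_le {w : List (Fin N)} {x : Plane} {K : ℝ}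
    (hx : ‖linMap (wordProd A w) x‖ ≤ K * alpha2 A w) (z : Plane) :
    alpha1 A w * |wedge x z| ≤ K * ‖linMap (wordProd A w) z‖ := by
  have h1 := abs_wedge_le (linMap (wordProd A w) x) (linMap (wordProd A w) z)
  rw [wedge_linMap, abs_mul, ← absDet, ← alpha1_mul_alpha2] at h1
  refine le_of_mul_le_mul_left ?_ (alpha2_pos A w)
  calc alpha2 A w * (alpha1 A w * |wedge x z|) = alpha1 A w * alpha2 A w * |wedge x z| := by ring
    _ ≤ _ := h1
    _ ≤ K * alpha2 A w * ‖linMap (wordProd A w) z‖ :=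
      mul_le_mul_of_nonneg_right hx (norm_nonneg _)
    _ = _ := by ring

theorem norm_linMap_le_of_contracted {w : List (Fin N)} {x : Plane} {K : ℝ} (hx1 : ‖x‖ = 1)
    (hx : ‖linMap (wordProd A w) x‖ ≤ K * alpha2 A w) (z : Plane) :
    ‖linMap (wordProd A w) z‖ ≤ ‖z‖ * (K * alpha2 A w) + |wedge x z| * alpha1 A w := by
  have h1 := wedge_smul_eq z x (rot x)
  rw [wedge_rot, hx1, one_pow, one_smul] at h1
  have h2 : |wedge z (rot x)| ≤ ‖z‖ := by simpa [norm_rot, hx1] using abs_wedge_le z (rot x)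
  have h3 : ‖linMap (wordProd A w) (rot x)‖ ≤ alpha1 A w := by
    simpa [norm_rot, hx1] using norm_linMap_le A w (rot x)
  conv_lhs => rw [h1]
  rw [map_add, map_smul, map_smul]
  refine (norm_add_le _ _).trans ?_
  rw [norm_smul, norm_smul, Real.norm_eq_abs, Real.norm_eq_abs]
  exact add_le_add (mul_le_mul h2 hx (norm_nonneg _) (norm_nonneg _))
    (mul_le_mul_of_nonneg_left h3 (abs_nonneg _))

/-- The pullback of an r-ball under A_w is an ellipse inside the strip parallel to x of half-width
Kr/α₁(w), and the strip is seen by the projection along x. -/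
theorem measureReal_preimage_linMap_le (hcontr : ∀ i, ‖linMap (A i)‖ < 1) {C K : ℝ} (hK : 0 < K)
    {V : ℙ ℝ Plane}
    (h : ∀ (x : Plane) (r : ℝ), 0 < r → ((μ.map (canonicalProj A v)).map (projPerp V)).real
      (projPerp V '' Metric.closedBall x r) ≤ C * r)
    {w : List (Fin N)} {x : Plane} (hxV : x ∈ V.submodule) (hx1 : ‖x‖ = 1)
    (hx : ‖linMap (wordProd A w) x‖ ≤ K * alpha2 A w) (y : Plane) {r : ℝ} (hr : 0 < r) :
    μ.real {j | ‖linMap (wordProd A w) (canonicalProj A v j - y)‖ ≤ r} ≤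
      C * (K * r / alpha1 A w) := by
  have ha := alpha1_pos A w
  have hmeas : MeasurableSet (projPerp V '' Metric.closedBall y (K * r / alpha1 A w)) :=
    ((isCompact_closedBall _ _).image (projPerp V).continuous).isClosed.measurableSet
  refine le_trans ?_ (h y (K * r / alpha1 A w) (by positivity))
  rw [map_measureReal_apply (projPerp V).continuous.measurable hmeas,
    measureReal_map_canonicalProj hcontr ((projPerp V).continuous.measurable hmeas)]
  refine measureReal_mono (fun j hj => ?_) (measure_ne_top _ _)
  have h1 := alpha1_mul_abs_wedge_le hx (canonicalProj A v j - y)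
  have h2 := norm_projPerp_le hxV hx1 (canonicalProj A v j - y)
  have hidem (z : Plane) : projPerp V (projPerp V z) = projPerp V z :=
    Submodule.starProjection_eq_self_iff.2 (Submodule.starProjection_apply_mem _ _)
  -- The point of the strip is slid along V until it is close to y; its projection is unchanged.
  refine ⟨y + projPerp V (canonicalProj A v j - y), ?_, ?_⟩
  · rw [Metric.mem_closedBall, dist_eq_norm, add_sub_cancel_left, le_div_iff₀ ha]
    have h3 : K * ‖linMap (wordProd A w) (canonicalProj A v j - y)‖ ≤ K * r :=
      mul_le_mul_of_nonneg_left hj hK.le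
    have h4 := mul_le_mul_of_nonneg_right h2 ha.le
    linarith
  · rw [map_add, hidem, ← map_add, add_sub_cancel]

theorem exists_measureReal_closedBall_le [Nonempty (Fin N)] (hcontr : ∀ i, ‖linMap (A i)‖ < 1)
    (hX : IsSelfAffineSet A v X) (hsep : StrongSeparation A v X) (hqB : IsQuasiBernoulli μ)
    {C K : ℝ} (hC : 0 ≤ C) (hK : 0 < K)
    (h : ∀ (x : Plane), ∀ V ∈ furstenbergDirections A, ∀ r : ℝ, 0 < r →
      ((μ.map (canonicalProj A v)).map (projPerp V)).real
        (projPerp V '' Metric.closedBall x r) ≤ C * r)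
    (hdir : ∀ w : List (Fin N), ∃ V ∈ furstenbergDirections A, ∃ x ∈ V.submodule,
      ‖x‖ = 1 ∧ ‖linMap (wordProd A w) x‖ ≤ K * alpha2 A w) :
    ∃ ρ C' : ℝ, 0 < ρ ∧ 0 ≤ C' ∧ ∀ (i : ℕ → Fin N) (n : ℕ) (r : ℝ), 0 < r →
      r ≤ ρ * alpha2 A (pre i n) →
      (μ.map (canonicalProj A v)).real (Metric.closedBall (canonicalProj A v i) r) ≤
        C' * (μ.real (wordCylinder (pre i n)) * (alpha2 A (pre i n) / alpha1 A (pre i n))) := by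
  obtain ⟨d, hd, hdist⟩ := exists_mul_alpha2_le_dist hX hcontr hsep
  obtain ⟨D, hD, hDμ⟩ := hqB.exists_measureReal_le
  have hD0 : 0 < D := one_pos.trans_le hD
  -- Half the separation constant keeps r strictly below the distance to all other cylinders of
  -- level n.
  refine ⟨d / 2, D * (C * K * (d / 2)), half_pos hd, by positivity, fun i n r hr hrd => ?_⟩
  set w := pre i n with hw
  have h1 := alpha1_pos A w
  have h2 := alpha2_pos A w
  obtain ⟨V, hV, x, hxV, hx1, hx⟩ := hdir w
  set y := canonicalProj A v (shift n i) with hy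
  set G : Set (ℕ → Fin N) := {j | ‖linMap (wordProd A w) (canonicalProj A v j - y)‖ ≤ r} with hG
  have hGclosed : IsClosed G := by
    have := continuous_canonicalProj v hcontr
    exact isClosed_le (by fun_prop) continuous_const
  have hGμ : μ.real G ≤ C * (K * r / alpha1 A w) :=
    measureReal_preimage_linMap_le hcontr hK (fun x r hr => h x V hV r hr) hxV hx1 hx y hr
  rw [measureReal_map_canonicalProj hcontr Metric.isClosed_closedBall.measurableSet]
  have hsub : canonicalProj A v ⁻¹' Metric.closedBall (canonicalProj A v i) r ⊆
      wordCylinder w ∩ shift n ⁻¹' G := by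
    intro j hj
    rw [Set.mem_preimage, Metric.mem_closedBall] at hj
    have hjw : j ∈ wordCylinder w := by
      by_contra hc
      have h3 := hdist i j n hc
      rw [← hw] at h3
      have h4 := mul_pos hd h2
      linarith
    refine ⟨hjw, ?_⟩
    rwa [dist_eq_norm, canonicalProj_sub v hcontr (mem_wordCylinder_pre.1 hjw)] at hj
  calc μ.real (canonicalProj A v ⁻¹' Metric.closedBall (canonicalProj A v i) r)
      ≤ μ.real (wordCylinder w ∩ shift n ⁻¹' G) := measureReal_mono hsub (measure_ne_top _ _)
    _ ≤ D * (μ.real (wordCylinder w) * μ.real G) := hDμ i n G hGclosed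
    _ ≤ D * (μ.real (wordCylinder w) * (C * (K * (d / 2 * alpha2 A w) / alpha1 A w))) := by
        have : C * (K * r / alpha1 A w) ≤ C * (K * (d / 2 * alpha2 A w) / alpha1 A w) := by
          gcongr
        exact mul_le_mul_of_nonneg_left
          (mul_le_mul_of_nonneg_left (hGμ.trans this) measureReal_nonneg) hD0.le
    _ = _ := by ring

/-- With a = α₁ and b = α₂, the factor a/b is the number of pieces of a cylinder and (b/a)^q the
q-th power of the relative mass of a piece; the last factor is bounded below when r is comparable to
b. -/
theorem alpha_rpow_identity {a b r : ℝ} (ha : 0 < a) (hb : 0 < b) (hr : 0 < r) (q t : ℝ) :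
    r ^ ((q - 1) * t) * (a * b ^ (t - 1)) ^ (1 - q) =
      a / b * (b / a) ^ q * (r / b) ^ ((q - 1) * t) := by
  have h1 : a * b ^ (t - 1) = a / b * b ^ t := by
    rw [Real.rpow_sub_one hb.ne']; ring
  have hab : 0 < a / b := div_pos ha hb
  have h2 : a / b * (b / a) ^ q = (a / b) ^ (1 - q) := by
    rw [Real.rpow_sub hab, Real.rpow_one, ← inv_div a b, Real.inv_rpow hab.le, ← div_eq_mul_inv]
  rw [h1, Real.mul_rpow hab.le (Real.rpow_nonneg hb.le _), mul_left_comm,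
    rpow_mul_rpow_rpow hr hb, h2]

theorem hasLqBound_of_projections [Nonempty (Fin N)] (hcontr : ∀ i, ‖linMap (A i)‖ < 1)
    (hX : IsSelfAffineSet A v X) (hdom : IsDominated A) (hsep : StrongSeparation A v X)
    (hqB : IsQuasiBernoulli μ) (hq : 1 < q) {C : ℝ} (hC : 0 ≤ C)
    (h : ∀ (x : Plane), ∀ V ∈ furstenbergDirections A, ∀ r : ℝ, 0 < r →
      ((μ.map (canonicalProj A v)).map (projPerp V)).real
        (projPerp V '' Metric.closedBall x r) ≤ C * r) (t : ℝ) :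
    HasLqBound X (μ.map (canonicalProj A v)) q ((q - 1) * t) fun w : List (Fin N) =>
      μ.real (wordCylinder w) ^ q * (alpha1 A w * alpha2 A w ^ (t - 1)) ^ (1 - q) := by
  obtain ⟨K, hK, hdir⟩ := exists_furstenbergDirection_contracted hcontr hdom
  obtain ⟨ρ, C', hρ, hC', hball⟩ :=
    exists_measureReal_closedBall_le hcontr hX hsep hqB hC hK h hdir
  choose V hV e heV he1 he using hdir
  obtain ⟨R₀, hR₀⟩ := hX.2.1.isBounded.exists_norm_le
  set R := max R₀ 0 with hRdef
  have hR0 : 0 ≤ R := le_max_right _ _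
  have hR (x : Plane) (hx : x ∈ X) : ‖x‖ ≤ R := (hR₀ x hx).trans (le_max_left _ _)
  obtain ⟨L, hL, hLA⟩ := exists_alpha_pre_le_succ A
  obtain ⟨code, hcode⟩ := hX.exists_code hcontr
  obtain ⟨c, hc, hcr⟩ := exists_le_rpow (div_pos hρ hL) ρ ((q - 1) * t)
  set B := (2 * R + 1) * C' ^ q / c with hB
  have hB0 : 0 ≤ B := div_nonneg (mul_nonneg (by linarith) (Real.rpow_nonneg hC' _)) hc.le
  set B' := L / ρ * (2 * R * K + 1) with hB'
  have hB'0 : 0 < B' := by positivity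
  refine ⟨max B B', ρ, lt_max_of_lt_right hB'0, hρ, fun r hr hrρ => ?_⟩
  have hn (x : Plane) : ∃ n, r ≤ ρ * alpha2 A (pre (code x) n) ∧
      ρ * alpha2 A (pre (code x) n) ≤ L * r :=
    exists_stopping (by simp [pre, alpha2_nil]) (tendsto_alpha2_pre hcontr _)
      (fun n => (hLA _ n).2) hL.le hρ hr hrρ.le
  choose n hn1 hn2 using hn
  set W : Plane → List (Fin N) := fun x => pre (code x) (n x) with hW
  set Y : Plane → Plane := fun x => canonicalProj A v (shift (n x) (code x)) with hY
  have hYR (x : Plane) : ‖Y x‖ ≤ R := hR _ (hX.canonicalProj_mem hcontr _)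
  have hwY (w : List (Fin N)) (x : Plane) : |wedge (e w) (Y x)| ≤ R := by
    refine (abs_wedge_le _ _).trans ?_
    rw [he1, one_mul]
    exact hYR x
  -- Cut the cylinder by the coordinate of the shifted point transversal to the contracted direction
  -- e(w). It ranges over [-R, R], and steps of length α₂/α₁ are mapped by A_w to length at most α₂.
  refine ⟨W, fun w => ⌊2 * R * (alpha1 A w / alpha2 A w)⌋₊ + 1,
    fun x => ⌊(wedge (e (W x)) (Y x) + R) * (alpha1 A (W x) / alpha2 A (W x))⌋₊,
    fun x hx => ⟨?_, ?_, ?_⟩⟩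
  · have h1 := alpha1_pos A (W x)
    have h2 := alpha2_pos A (W x)
    refine Nat.lt_succ_of_le (Nat.floor_le_floor ?_)
    refine mul_le_mul_of_nonneg_right ?_ (div_pos h1 h2).le
    linarith [(abs_le.1 (hwY (W x) x)).2]
  · have h1 := alpha1_pos A (W x)
    have h2 := alpha2_pos A (W x)
    have h12 : 1 ≤ alpha1 A (W x) / alpha2 A (W x) := (one_le_div h2).2 (alpha2_le_alpha1 A _)
    have h3 := hball (code x) (n x) r hr (hn1 x)
    rw [hcode x hx] at h3
    change _ ≤ C' * (μ.real (wordCylinder (W x)) * (alpha2 A (W x) / alpha1 A (W x))) at h3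
    have h4 := hcr (r / alpha2 A (W x))
      (by
        have : ρ * alpha2 A (W x) ≤ L * r := hn2 x
        rw [div_le_div_iff₀ hL h2]
        linarith)
      (by rw [div_le_iff₀ h2]; exact hn1 x)
    have h5 : ((⌊2 * R * (alpha1 A (W x) / alpha2 A (W x))⌋₊ + 1 : ℕ) : ℝ) ≤
        (2 * R + 1) * (alpha1 A (W x) / alpha2 A (W x)) := by
      have := Nat.floor_le (a := 2 * R * (alpha1 A (W x) / alpha2 A (W x)))
        (mul_nonneg (by linarith) (by linarith))
      push_cast
      linarith
    have hμ : (0 : ℝ) ≤ μ.real (wordCylinder (W x)) ^ q := Real.rpow_nonneg measureReal_nonneg _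
    have h6 : (μ.map (canonicalProj A v)).real (Metric.closedBall x r) ^ q ≤
        C' ^ q * (μ.real (wordCylinder (W x)) ^ q * (alpha2 A (W x) / alpha1 A (W x)) ^ q) := by
      rw [← Real.mul_rpow measureReal_nonneg (div_pos h2 h1).le,
        ← Real.mul_rpow hC' (mul_nonneg measureReal_nonneg (div_pos h2 h1).le)]
      exact Real.rpow_le_rpow measureReal_nonneg h3 (by linarith)
    have hP : 0 ≤ μ.real (wordCylinder (W x)) ^ q *
        (alpha1 A (W x) / alpha2 A (W x) * (alpha2 A (W x) / alpha1 A (W x)) ^ q) :=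
      mul_nonneg hμ (mul_nonneg (by linarith) (Real.rpow_nonneg (div_pos h2 h1).le _))
    calc ((⌊2 * R * (alpha1 A (W x) / alpha2 A (W x))⌋₊ + 1 : ℕ) : ℝ) *
          (μ.map (canonicalProj A v)).real (Metric.closedBall x r) ^ q
        ≤ (2 * R + 1) * (alpha1 A (W x) / alpha2 A (W x)) *
          (C' ^ q * (μ.real (wordCylinder (W x)) ^ q *
            (alpha2 A (W x) / alpha1 A (W x)) ^ q)) :=
          mul_le_mul h5 h6 (Real.rpow_nonneg measureReal_nonneg _)
            (mul_nonneg (by linarith) (by linarith))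
      _ = B * (μ.real (wordCylinder (W x)) ^ q *
            (alpha1 A (W x) / alpha2 A (W x) * (alpha2 A (W x) / alpha1 A (W x)) ^ q)) * c := by
          rw [hB]; field_simp
      _ ≤ max B B' * (μ.real (wordCylinder (W x)) ^ q *
            (alpha1 A (W x) / alpha2 A (W x) * (alpha2 A (W x) / alpha1 A (W x)) ^ q)) *
            (r / alpha2 A (W x)) ^ ((q - 1) * t) :=
          mul_le_mul (mul_le_mul_of_nonneg_right (le_max_left _ _) hP) h4 hc.le
            (mul_nonneg (hB0.trans (le_max_left _ _)) hP)
      _ = max B B' * μ.real (wordCylinder (W x)) ^ q *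
            (alpha1 A (W x) / alpha2 A (W x) * (alpha2 A (W x) / alpha1 A (W x)) ^ q *
            (r / alpha2 A (W x)) ^ ((q - 1) * t)) := by ring
      _ = _ := by
          rw [← alpha_rpow_identity h1 h2 hr]; ring
  · intro y hy hyx hcell
    have h1 := alpha1_pos A (W x)
    have h2 := alpha2_pos A (W x)
    have hlen : n y = n x := by simpa [hW] using congrArg List.length hyx
    have hagree : code y ∈ wordCylinder (pre (code x) (n x)) := by
      have : pre (code y) (n y) = pre (code x) (n x) := hyx
      rw [← this]
      exact self_mem_wordCylinder_pre _ _
    have hsub : y - x = linMap (wordProd A (W x)) (Y y - Y x) := by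
      have := canonicalProj_sub v hcontr (mem_wordCylinder_pre.1 hagree)
      rw [hcode x hx, hcode y hy] at this
      rw [this, hY]
      simp only [hlen, hW]
    simp only [hyx] at hcell
    have hnn (z : Plane) : 0 ≤ (wedge (e (W x)) (Y z) + R) * (alpha1 A (W x) / alpha2 A (W x)) :=
      mul_nonneg (by linarith [(abs_le.1 (hwY (W x) z)).1]) (div_pos h1 h2).le
    have hw : wedge (e (W x)) (Y y - Y x) = wedge (e (W x)) (Y y) - wedge (e (W x)) (Y x) := by
      simp [wedge]; ring
    -- Equal floors place the transversal coordinates within one step; the remaining direction is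
    -- contracted to O(α₂) by A_w.
    have hclose : |wedge (e (W x)) (Y y - Y x)| * (alpha1 A (W x) / alpha2 A (W x)) ≤ 1 := by
      rw [← abs_of_pos (div_pos h1 h2), ← abs_mul, hw, abs_le]
      have f1 := Nat.floor_le (hnn x)
      have f2 := Nat.floor_le (hnn y)
      have f3 := Nat.lt_floor_add_one ((wedge (e (W x)) (Y x) + R) *
        (alpha1 A (W x) / alpha2 A (W x)))
      have f4 := Nat.lt_floor_add_one ((wedge (e (W x)) (Y y) + R) *
        (alpha1 A (W x) / alpha2 A (W x)))
      rw [hcell] at f2 f4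
      constructor <;> linarith
    rw [mul_div_assoc', div_le_one h2] at hclose
    rw [dist_comm, dist_eq_norm, hsub]
    have hYY : ‖Y y - Y x‖ ≤ 2 * R := by
      linarith [norm_sub_le (Y y) (Y x), hYR x, hYR y]
    calc ‖linMap (wordProd A (W x)) (Y y - Y x)‖
        ≤ ‖Y y - Y x‖ * (K * alpha2 A (W x)) + |wedge (e (W x)) (Y y - Y x)| * alpha1 A (W x) :=
          norm_linMap_le_of_contracted (he1 _) (he _) _
      _ ≤ 2 * R * (K * alpha2 A (W x)) + alpha2 A (W x) := by gcongr
      _ = (2 * R * K + 1) * alpha2 A (W x) := by ring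
      _ ≤ (2 * R * K + 1) * (L * r / ρ) := by
          refine mul_le_mul_of_nonneg_left ?_ (by positivity)
          rw [le_div_iff₀ hρ, mul_comm]
          exact hn2 x
      _ = B' * r := by rw [hB']; ring
      _ ≤ _ := mul_le_mul_of_nonneg_right (le_max_right _ _) hr.le

end Projections

end SelfAffine

theorem mainTheorem8 {N : ℕ} (A : Fin N → GL (Fin 2) ℝ) (v : Fin N → SelfAffine.Plane)
    (X : Set SelfAffine.Plane) (μ : Measure (ℕ → Fin N)) [IsProbabilityMeasure μ] (q : ℝ)
    (hcontr : ∀ i, ‖SelfAffine.linMap (A i)‖ < 1)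
    (hX : SelfAffine.IsSelfAffineSet A v X)
    (hdom : SelfAffine.IsDominated A)
    (hsep : SelfAffine.StrongSeparation A v X)
    (hfull : SelfAffine.IsFullySupported μ)
    (hqB : SelfAffine.IsQuasiBernoulli μ)
    (hq : 1 < q)
    (h :
      (SelfAffine.lqSpectrum A μ q / (q - 1) ∈ Set.Icc (0 : ℝ) 1 ∧
        ∃ ρ C : ℝ, 0 < ρ ∧ 1 ≤ C ∧ ∀ (i : ℕ → Fin N) (n : ℕ),
          (μ.map (SelfAffine.canonicalProj A v)).real
              (Metric.closedBall (SelfAffine.canonicalProj A v i)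
                (ρ * SelfAffine.alpha1 A (SelfAffine.pre i n))) ≤
            C * μ.real (SelfAffine.wordCylinder (SelfAffine.pre i n))) ∨
      (SelfAffine.lqSpectrum A μ q / (q - 1) ∈ Set.Icc (1 : ℝ) 2 ∧
        ∃ C : ℝ, 1 ≤ C ∧ ∀ (x : SelfAffine.Plane), ∀ V ∈ SelfAffine.furstenbergDirections A,
          ∀ r : ℝ, 0 < r →
            ((μ.map (SelfAffine.canonicalProj A v)).map (SelfAffine.projPerp V)).real
                (SelfAffine.projPerp V '' Metric.closedBall x r) ≤ C * r)) :
    ∀ s : ℝ, 0 ≤ s →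
      SelfAffine.hausdorffDim
          (SelfAffine.levelSet X (μ.map (SelfAffine.canonicalProj A v)) s) ≤
        ((q * s - SelfAffine.lqSpectrum A μ q : ℝ) : EReal) := by
  intro s _
  obtain ⟨x₀, hx₀⟩ := hX.1
  obtain ⟨i₀, -⟩ := hX.exists_canonicalProj_eq hcontr hx₀
  have : Nonempty (Fin N) := ⟨i₀ 0⟩
  have hq1 : 0 < q - 1 := sub_pos.2 hq
  have hτ : SelfAffine.lqSpectrum A μ q = (q - 1) * SelfAffine.pressureZero A μ q := by
    rw [SelfAffine.lqSpectrum, if_neg hq.ne']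
  refine SelfAffine.hausdorffDim_levelSet_le (ι := List (Fin N)) (by linarith)
    (fun x hx r hr => SelfAffine.measureReal_closedBall_pos hcontr hX hfull hx hr)
    fun T hT => ?_
  rw [hτ, mul_div_cancel_left₀ _ hq1.ne'] at h
  rw [hτ, ← div_lt_iff₀' hq1] at hT
  -- The exponent t = T/(q-1) is strictly below s_q, hence strictly below 1 or 2 in the respective
  -- case, so the endpoint values of s_q cause no trouble.
  have hTt : T = (q - 1) * (T / (q - 1)) := (mul_div_cancel₀ _ hq1.ne').symm
  rcases h with ⟨⟨-, hs1⟩, ρ, C, hρ, hC, h⟩ | ⟨⟨-, hs2⟩, C, hC, h⟩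
  · refine ⟨_, fun w => ?_, SelfAffine.summable_measure_mul_alpha1 hcontr hfull hqB hq
      (hT.trans_le hs1) hT, ?_⟩
    · exact mul_nonneg (Real.rpow_nonneg measureReal_nonneg _)
        (Real.rpow_nonneg (Real.rpow_nonneg (SelfAffine.alpha1_pos A w).le _) _)
    · have := SelfAffine.hasLqBound_of_ball_le_cylinder hcontr hX hq hρ hC h (T / (q - 1))
      rwa [← hTt] at this
  · refine ⟨_, fun w => ?_, SelfAffine.summable_measure_mul_alpha1_mul_alpha2 hcontr hfull hqB hq
      (hT.trans_le hs2) hT, ?_⟩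
    · exact mul_nonneg (Real.rpow_nonneg measureReal_nonneg _)
        (Real.rpow_nonneg (mul_nonneg (SelfAffine.alpha1_pos A w).le
          (Real.rpow_nonneg (SelfAffine.alpha2_pos A w).le _)) _)
    · have := SelfAffine.hasLqBound_of_projections hcontr hX hdom hsep hqB hq
        (zero_le_one.trans hC) h (T / (q - 1))
      rwa [← hTt] at this
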